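/- Let $\Omega$ be an open (geodesically) convex subset of hyperbolic space $\mathbb H^n$, let $d$ be the hyperbolic distance, and let $\mathcal P$ be the set of supporting hyperplanes of $\Omega$, i.e. of the totally geodesic hyperplanes that meet $\partial\Omega$ and bound an open half-space containing $\Omega$. For distinct $x,y\in\Omega$ let $R(x,y)$ be the open geodesic ray $\{\exp_x(t\xi_{xy}):t>0\}$ from $x$ through $y$, where $\xi_{xy}\in T_x\mathbb H^n$ is the unit vector pointing towards $y$, and, when $R(x,y)$ meets $\partial\Omega$, let $b(x,y)$ be the (unique) intersection point. The hyperbolic Funk metric of $\Omega$ is $$F(x,y)=\log\frac{\sinh d(x,b(x,y))}{\sinh d(y,b(x,y))}\quad\text{if } x\ne y \text{ and } R(x,y)\cap\partial\Omega\neq\emptyset,\qquad F(x,y)=0 \text{ otherwise.}$$ For $x\in\Omega$ and $\xi\in T_x\mathbb H^n$ put $$p_{\Omega,x}(\xi)=\sup_{\pi\in\mathcal P}\coth d(x,\pi)\,\langle\eta_\pi(x),\xi\rangle ,\qquad \tilde p_{\Omega,x}(\xi)=\sup_{\pi\in\mathcal P}\coth d(x,T(x,\xi,\pi))\,\|\xi\|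 ,$$ where $\eta_\pi(x)$ is the unit tangent vector at $x$ whose direction is opposite to that of the gradient of $d(\cdot,\pi)$, and $T(x,\xi,\pi)$ is the intersection point of $\pi$ with the ray $\{\exp_x(t\xi):t>0\}$ (if the ray misses $\pi$, then $d(x,T(x,\xi,\pi))=\infty$ and $\coth\infty=1$; a supremum over $\mathcal P=\emptyset$ is $0$). Then: 1. For every $x\in\Omega$ the two suprema are finite, and $p_{\Omega,x}$ and $\tilde p_{\Omega,x}$ are weak norms on $T_x\mathbb H^n$, i.e. convex functions vanishing at $0$. 2. If $x\in\Omega$ and $\xi\in T_x\mathbb H^n$ are such that the ray $\{\exp_x(t\xi):t>0\}$ is not contained in $\Omega$, then $\tilde p_{\Omega,x}(\xi)=p_{\Omega,x}(\xi)$. 3. Let $x,y\in\Omega$ be such that $x=y$ or $R(x,y)$ is not contained in $\Omega$. Then $$F(x,y)=\inf_\gamma\int_a^b p_{\Omega,\gamma(t)}(\gamma'(t))\,dt=\inf_\gamma\int_a^b \tilde p_{\Omega,\gamma(t)}(\gamma'(t))\,dt ,$$ where $\gamma:[a,b]\to\Omega$ runs over the piecewise $C^1$ curves from $x$ to $y$,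 and all these integrals exist. 4. If $R(x,y)\not\subseteq\Omega$ for all distinct $x,y\in\Omega$ (for instance, if $\Omega$ is bounded), then $F$ is a weak metric on $\Omega$: $F\ge 0$, $F(x,x)=0$ and $F(x,z)\le F(x,y)+F(y,z)$. By 3, it is then the Finsler distance of $p_{\Omega,\cdot}$ on all of $\Omega$. -/

import Mathlib

noncomputable section

namespace HypFunk

/-! Hyperbolic `n`-space, in the hyperboloid model. -/

/-- Lorentzian space `ℝ^{1,n}`: a time coordinate and `n` space coordinates. -/
abbrev Lorentz (n : ℕ) : Type := ℝ × EuclideanSpace ℝ (Fin n)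

/-- The Lorentzian bilinear form of signature `(n, 1)`. -/
def lor {n : ℕ} (u v : Lorentz n) : ℝ := inner ℝ u.2 v.2 - u.1 * v.1

/-- Hyperbolic space: the upper sheet of the hyperboloid `lor u u = -1`, with the topology
induced from the ambient space. -/
abbrev Hyp (n : ℕ) : Type := {u : Lorentz n // lor u u = -1 ∧ 0 < u.1}

/-- The hyperbolic distance, `cosh d(x, y) = - lor x y`. -/
def hdist {n : ℕ} (x y : Hyp n) : ℝ := Real.arcosh (-lor x.1 y.1)

/-- The hyperbolic distance from a point to a set. -/
def setDist {n : ℕ} (x : Hyp n) (S : Set (Hyp n)) : ℝ := sInf (hdist x '' S)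

/-- The tangent space at `x`, as a subspace of the ambient space. The Riemannian metric of
hyperbolic space is the restriction of `lor` to it. -/
def tangent {n : ℕ} (x : Hyp n) : Submodule ℝ (Lorentz n) where
  carrier := {ξ | lor x.1 ξ = 0}
  add_mem' := by
    intro a b ha hb
    simp only [Set.mem_ofPred_eq, lor, Prod.fst_add, Prod.snd_add, inner_add_right] at *
    linarith
  zero_mem' := by simp [lor]
  smul_mem' := by
    intro c a ha
    simp only [Set.mem_ofPred_eq, lor, Prod.smul_fst, Prod.smul_snd, inner_smul_right,
      smul_eq_mul] at *
    linear_combination c * ha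

/-- The Riemannian norm of a tangent vector. -/
def hnorm {n : ℕ} (ξ : Lorentz n) : ℝ := Real.sqrt (lor ξ ξ)

/-- The exponential map `exp_x ξ`, for `ξ` tangent at `x`
(`exp_x 0 = x`, since `sinh 0 / 0 = 0` here). The value lies on the hyperboloid. -/
def hexp {n : ℕ} (x : Hyp n) (ξ : Lorentz n) : Lorentz n :=
  Real.cosh (hnorm ξ) • x.1 + (Real.sinh (hnorm ξ) / hnorm ξ) • ξ

/-- For `x ≠ y`, the unit vector at `x` tangent to the geodesic from `x` to `y`. -/
def unitDir {n : ℕ} (x y : Hyp n) : Lorentz n :=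
  (Real.sinh (hdist x y))⁻¹ • (y.1 + lor x.1 y.1 • x.1)

/-- The open geodesic ray `{exp_x (t ξ) : t > 0}`. -/
def ray {n : ℕ} (x : Hyp n) (ξ : Lorentz n) : Set (Hyp n) :=
  {z | ∃ t : ℝ, 0 < t ∧ z.1 = hexp x (t • ξ)}

/-- The geodesic segment from `x` to `y`. -/
def geodSegment {n : ℕ} (x y : Hyp n) : Set (Hyp n) :=
  {z | ∃ t : ℝ, 0 ≤ t ∧ t ≤ hdist x y ∧ z.1 = hexp x (t • unitDir x y)}

/-- Geodesic convexity. -/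
def HConvex {n : ℕ} (Ω : Set (Hyp n)) : Prop :=
  ∀ x ∈ Ω, ∀ y ∈ Ω, geodSegment x y ⊆ Ω

/-- `π` is a supporting hyperplane of `Ω`: a totally geodesic hyperplane (the trace on the
hyperboloid of the orthogonal complement of a spacelike vector `v`) that touches `Ω` at some
boundary point and bounds an open half-space containing `Ω`. -/
def IsSupporting {n : ℕ} (Ω π : Set (Hyp n)) : Prop :=
  ∃ v : Lorentz n, 0 < lor v v ∧ π = {z | lor z.1 v = 0} ∧
    (∀ z ∈ Ω, lor z.1 v < 0) ∧ ∃ b ∈ frontier Ω, b ∈ π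

/-- `g` is the Riemannian gradient of `f` at `x`: the tangent vector representing the
differential of `f`, which is computed along the differentiable curves through `x`. -/
def IsGradient {n : ℕ} (f : Hyp n → ℝ) (x : Hyp n) (g : Lorentz n) : Prop :=
  g ∈ tangent x ∧ ∀ (c : ℝ → Hyp n) (ξ : Lorentz n), c 0 = x →
    HasDerivAt (fun t => (c t).1) ξ 0 → HasDerivAt (fun t => f (c t)) (lor g ξ) 0

/-- `η = η_π(x)`: the unit tangent vector at `x` whose direction is opposite to the gradient
of `d(·, π)` at `x`. -/
def IsEta {n : ℕ} (π : Set (Hyp n)) (x : Hyp n) (η : Lorentz n) : Prop :=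
  η ∈ tangent x ∧ lor η η = 1 ∧
    ∃ c : ℝ, 0 < c ∧ IsGradient (fun z => setDist z π) x (-(c • η))

/-- The numbers `coth d(x, π) ⟨η_π(x), ξ⟩`, for `π` a supporting hyperplane. -/
def minkowskiSet {n : ℕ} (Ω : Set (Hyp n)) (x : Hyp n) (ξ : Lorentz n) : Set ℝ :=
  {r | ∃ π η, IsSupporting Ω π ∧ IsEta π x η ∧
    r = Real.cosh (setDist x π) / Real.sinh (setDist x π) * lor η ξ}

/-- The Minkowski functional `p_{Ω,x}(ξ) = sup_π coth d(x, π) ⟨η_π(x), ξ⟩`. -/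
def minkowski {n : ℕ} (Ω : Set (Hyp n)) (x : Hyp n) (ξ : Lorentz n) : ℝ :=
  sSup (minkowskiSet Ω x ξ)

open Classical in
/-- `coth d(x, T)`, where `T = T(x, ξ, π)` is the intersection of `π` with the geodesic ray from
`x` in the direction `ξ`. If the ray misses `π`, the distance is infinite, and `coth ∞ = 1`. -/
def cothT {n : ℕ} (x : Hyp n) (ξ : Lorentz n) (π : Set (Hyp n)) : ℝ :=
  if (π ∩ ray x ξ).Nonempty then
    Real.cosh (setDist x (π ∩ ray x ξ)) / Real.sinh (setDist x (π ∩ ray x ξ))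
  else 1

/-- The numbers `coth d(x, T(x, ξ, π)) ‖ξ‖`, for `π` a supporting hyperplane. -/
def rayMinkowskiSet {n : ℕ} (Ω : Set (Hyp n)) (x : Hyp n) (ξ : Lorentz n) : Set ℝ :=
  {r | ∃ π, IsSupporting Ω π ∧ r = cothT x ξ π * hnorm ξ}

/-- The other form of the Minkowski functional, `sup_π coth d(x, T(x, ξ, π)) ‖ξ‖`. -/
def rayMinkowski {n : ℕ} (Ω : Set (Hyp n)) (x : Hyp n) (ξ : Lorentz n) : ℝ :=
  sSup (rayMinkowskiSet Ω x ξ)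

open Classical in
/-- The hyperbolic Funk metric of `Ω`. The point `b(x, y)` is the intersection point (unique if
`Ω` is open and convex) of the boundary of `Ω` with the geodesic ray from `x` through `y`. -/
def funk {n : ℕ} (Ω : Set (Hyp n)) (x y : Hyp n) : ℝ :=
  if h : x ≠ y ∧ (ray x (unitDir x y) ∩ frontier Ω).Nonempty then
    Real.log (Real.sinh (hdist x h.2.some) / Real.sinh (hdist y h.2.some))
  else 0

/-- `γ` restricts to a piecewise `C¹` curve `[a, b] → Ω` from `x` to `y`: there is a subdivision
of `[a, b]` such that `γ` is `C¹` on each closed piece. -/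
def IsPiecewiseC1Path {n : ℕ} (Ω : Set (Hyp n)) (x y : Hyp n) (a b : ℝ) (γ : ℝ → Hyp n) : Prop :=
  a < b ∧ γ a = x ∧ γ b = y ∧ (∀ t ∈ Set.Icc a b, γ t ∈ Ω) ∧
    ∃ (m : ℕ) (s : ℕ → ℝ), s 0 = a ∧ s m = b ∧ ∀ i < m, s i < s (i + 1) ∧
      ContDiffOn ℝ 1 (fun t => (γ t).1) (Set.Icc (s i) (s (i + 1)))

/-- The integrand `p_{γ(t)}(γ'(t))`; the velocity exists except at finitely many times. -/
def speed {n : ℕ} (p : Hyp n → Lorentz n → ℝ) (γ : ℝ → Hyp n) (t : ℝ) : ℝ :=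
  p (γ t) (deriv (fun u => (γ u).1) t)

/-- The `p`-lengths of the piecewise `C¹` curves in `Ω` from `x` to `y`. -/
def lengths {n : ℕ} (Ω : Set (Hyp n)) (p : Hyp n → Lorentz n → ℝ) (x y : Hyp n) : Set ℝ :=
  {L | ∃ (a b : ℝ) (γ : ℝ → Hyp n), IsPiecewiseC1Path Ω x y a b γ ∧
    L = ∫ t in a..b, speed p γ t}

/-- A family of weak norms on the tangent spaces of `Ω`: zero at zero, and convex. -/
def IsWeakNormOn {n : ℕ} (Ω : Set (Hyp n)) (p : Hyp n → Lorentz n → ℝ) : Prop :=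
  ∀ x ∈ Ω, p x 0 = 0 ∧ ConvexOn ℝ (tangent x : Set (Lorentz n)) (p x)

/-- Weak metrics on `Ω`. -/
def IsWeakMetricOn {n : ℕ} (Ω : Set (Hyp n)) (δ : Hyp n → Hyp n → ℝ) : Prop :=
  (∀ x ∈ Ω, ∀ y ∈ Ω, 0 ≤ δ x y) ∧ (∀ x ∈ Ω, δ x x = 0) ∧
    ∀ x ∈ Ω, ∀ y ∈ Ω, ∀ z ∈ Ω, δ x z ≤ δ x y + δ y z

/-- The Finsler distance of `p` from `x` to `y` is defined and equal to `D`: `p` is integrable along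
every piecewise `C¹` curve in `Ω` from `x` to `y`, and the infimum of the lengths is `D`. -/
def FinslerDistEq {n : ℕ} (Ω : Set (Hyp n)) (p : Hyp n → Lorentz n → ℝ) (x y : Hyp n)
    (D : ℝ) : Prop :=
  (∀ (a b : ℝ) (γ : ℝ → Hyp n), IsPiecewiseC1Path Ω x y a b γ →
    IntervalIntegrable (speed p γ) MeasureTheory.volume a b) ∧
  IsGLB (lengths Ω p x y) D

end HypFunk

end

/-! In the hyperboloid model a supporting hyperplane is the trace of `v`-orthogonality for a unit
spacelike `v` that is negative on `Ω`, and `sinh d(x, π) = -lor x v`. Hence `coth d(x, π) ⟨η_π(x),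
ξ⟩` collapses to `lor v ξ / -lor x v`, the derivative at `x` in direction `ξ` of `-log (-lor · v)`.
So `p` is a supremum of differentials of explicit functions (`minkowskiSet_eq`), hence convex in
`ξ`; in the ray form each slope is merely replaced by its maximum with `‖ξ‖` (`cothT_hyperplane`).

Suppose the ray from `x` through `y` meets the frontier at `b`. As `y` is a positive combination of
`x` and `b`, and `lor b v ≤ 0`, every `v` satisfies `log (-lor x v) - log (-lor y v) ≤ F(x, y)`,
with equality when the hyperplane passes through `b`. Such a hyperplane comes from Hahn–Banach
applied to the open convex cone over `Ω` (`exists_unitNormal`). Thus `F` is a maximum of differences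
of potentials, which gives the triangle inequality.

Integrating the differential of the maximizing potential along a curve bounds its length below by
`F(x, y)`. On the geodesic segment the hyperplane at `b` has the largest slope at all times, namely
`coth` of the remaining distance to `b`; its integral is exactly `F(x, y)` (`slopeSup_geo`). There
the slope is at least the speed, so the ray form has the same length. -/

namespace HypFunk

/-! ### Lorentzian linear algebra -/

/-- Pairing with a fixed vector `v`, as a continuous linear functional. -/
noncomputable def lorL {n : ℕ} (v : Lorentz n) : Lorentz n →L[ℝ] ℝ :=
  (innerSL ℝ v.2).comp (ContinuousLinearMap.snd ℝ ℝ (EuclideanSpace ℝ (Fin n))) -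
    v.1 • ContinuousLinearMap.fst ℝ ℝ (EuclideanSpace ℝ (Fin n))

theorem lorL_apply {n : ℕ} (v u : Lorentz n) : lorL v u = lor u v := by
  simp [lorL, lor, real_inner_comm, mul_comm]

theorem lor_comm {n : ℕ} (u v : Lorentz n) : lor u v = lor v u := by
  simp only [lor, real_inner_comm v.2, mul_comm v.1]

theorem lor_add_left {n : ℕ} (u v w : Lorentz n) : lor (u + v) w = lor u w + lor v w := by
  simp only [← lorL_apply, map_add]

theorem lor_smul_left {n : ℕ} (c : ℝ) (u w : Lorentz n) : lor (c • u) w = c * lor u w := by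
  simp only [← lorL_apply, map_smul, smul_eq_mul]

theorem lor_neg_left {n : ℕ} (u w : Lorentz n) : lor (-u) w = -lor u w := by
  simp only [← lorL_apply, map_neg]

theorem lor_sub_left {n : ℕ} (u v w : Lorentz n) : lor (u - v) w = lor u w - lor v w := by
  simp only [← lorL_apply, map_sub]

theorem lor_zero_left {n : ℕ} (w : Lorentz n) : lor 0 w = 0 := by
  simp only [← lorL_apply, map_zero]

theorem lor_add_right {n : ℕ} (u v w : Lorentz n) : lor w (u + v) = lor w u + lor w v := by
  simp only [lor_comm w, lor_add_left]

theorem lor_smul_right {n : ℕ} (c : ℝ) (u w : Lorentz n) : lor w (c • u) = c * lor w u := by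
  simp only [lor_comm w, lor_smul_left]

theorem lor_neg_right {n : ℕ} (u w : Lorentz n) : lor w (-u) = -lor w u := by
  simp only [lor_comm w, lor_neg_left]

theorem lor_sub_right {n : ℕ} (u v w : Lorentz n) : lor w (u - v) = lor w u - lor w v := by
  simp only [lor_comm w, lor_sub_left]

theorem lor_zero_right {n : ℕ} (w : Lorentz n) : lor w 0 = 0 := by
  rw [lor_comm, lor_zero_left]

theorem continuous_lor_self {n : ℕ} : Continuous fun u : Lorentz n => lor u u := by
  unfold lor; fun_prop

/-- Riesz representation with the time coordinate negated; it turns the Hahn–Banach functional into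
a normal vector. -/
theorem exists_eq_lor {n : ℕ} (f : Lorentz n →L[ℝ] ℝ) : ∃ v : Lorentz n, ∀ u, f u = lor u v := by
  let g : EuclideanSpace ℝ (Fin n) →L[ℝ] ℝ :=
    f.comp (ContinuousLinearMap.inr ℝ ℝ (EuclideanSpace ℝ (Fin n)))
  refine ⟨(-f (1, 0), (InnerProductSpace.toDual ℝ _).symm g), fun u => ?_⟩
  have h1 : inner ℝ u.2 ((InnerProductSpace.toDual ℝ _).symm g) = f (0, u.2) := by
    rw [real_inner_comm, InnerProductSpace.toDual_symm_apply]
    simp [g]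
  have h2 : u = u.1 • ((1, 0) : Lorentz n) + ((0, u.2) : Lorentz n) := by
    ext <;> simp
  simp only [lor, h1]
  conv_lhs => rw [h2]
  rw [map_add, map_smul, smul_eq_mul]
  ring

/-! ### Timelike and spacelike vectors -/

theorem Hyp.norm_snd_lt {n : ℕ} (x : Hyp n) : ‖x.1.2‖ < x.1.1 := by
  obtain ⟨h, h0⟩ := x.2
  simp only [lor, real_inner_self_eq_norm_sq] at h
  nlinarith [norm_nonneg x.1.2]

/-- Vectors orthogonal to a point of the hyperboloid are spacelike. -/
theorem lor_self_pos_of_orthogonal {n : ℕ} (x : Hyp n) {ξ : Lorentz n} (h : lor x.1 ξ = 0)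
    (hne : ξ ≠ 0) : 0 < lor ξ ξ := by
  have hx := x.norm_snd_lt
  have hcs := abs_real_inner_le_norm x.1.2 ξ.2
  have h' : inner ℝ x.1.2 ξ.2 = x.1.1 * ξ.1 := by simp only [lor] at h; linarith
  have h0 := x.2.2
  rw [h', abs_mul, abs_of_pos h0] at hcs
  simp only [lor, real_inner_self_eq_norm_sq]
  rcases (norm_nonneg ξ.2).eq_or_lt with h2 | h2
  · rw [← h2] at hcs
    have h1 : ξ.1 = 0 := by
      have : |ξ.1| ≤ 0 := by
        by_contra hc
        push Not at hc
        nlinarith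
      exact abs_eq_zero.1 (le_antisymm this (abs_nonneg _))
    exact absurd (Prod.ext h1 (norm_eq_zero.1 h2.symm)) hne
  · have : |ξ.1| < ‖ξ.2‖ := by
      by_contra hc
      push Not at hc
      nlinarith
    have := sq_lt_sq' (by linarith [abs_nonneg ξ.1]) this
    rw [sq_abs] at this
    nlinarith

theorem lor_self_nonneg_of_orthogonal {n : ℕ} (x : Hyp n) {ξ : Lorentz n} (h : lor x.1 ξ = 0) :
    0 ≤ lor ξ ξ := by
  rcases eq_or_ne ξ 0 with rfl | hne
  · rw [lor_zero_left]
  · exact (lor_self_pos_of_orthogonal x h hne).le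

/-- A reversed Cauchy–Schwarz argument: the sign of the pairing with one point of the upper sheet
decides the sheet. This is how vectors built algebraically are recognized as points of `Hyp`. -/
theorem fst_pos_of_lor_neg {n : ℕ} (x : Hyp n) {u : Lorentz n} (hu : lor u u < 0)
    (h : lor x.1 u < 0) : 0 < u.1 := by
  have hx := x.norm_snd_lt
  have hcs := (abs_le.1 (abs_real_inner_le_norm x.1.2 u.2)).1
  by_contra hc
  push Not at hc
  simp only [lor, real_inner_self_eq_norm_sq] at hu h
  have h2 : ‖u.2‖ ≤ -u.1 := by nlinarith [norm_nonneg u.2]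
  nlinarith [norm_nonneg u.2, norm_nonneg x.1.2, mul_le_mul hx.le h2 (norm_nonneg _) x.2.2.le]

theorem lor_neg_of_fst_pos {n : ℕ} (x : Hyp n) {u : Lorentz n} (hu : lor u u < 0)
    (h : 0 < u.1) : lor x.1 u < 0 := by
  have hx := x.norm_snd_lt
  have hcs := real_inner_le_norm x.1.2 u.2
  simp only [lor, real_inner_self_eq_norm_sq] at hu ⊢
  have h2 : ‖u.2‖ < u.1 := by nlinarith [norm_nonneg u.2]
  nlinarith [norm_nonneg u.2, norm_nonneg x.1.2, mul_le_mul hx.le h2.le (norm_nonneg _) x.2.2.le,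
    mul_pos (sub_pos.2 hx) h]

theorem lor_hyp_neg {n : ℕ} (x y : Hyp n) : lor x.1 y.1 < 0 :=
  lor_neg_of_fst_pos x (by rw [y.2.1]; norm_num) y.2.2

/-- The component of `y` orthogonal to `x` is spacelike, and its square is `(lor x y)² - 1`. -/
theorem one_lt_neg_lor {n : ℕ} {x y : Hyp n} (h : x ≠ y) : 1 < -lor x.1 y.1 := by
  have hneg := lor_hyp_neg x y
  have ht : lor x.1 (y.1 + lor x.1 y.1 • x.1) = 0 := by
    rw [lor_add_right, lor_smul_right, x.2.1]; ring
  have hne : y.1 + lor x.1 y.1 • x.1 ≠ 0 := by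
    intro h0
    have hy : y.1 = (-lor x.1 y.1) • x.1 := by rw [neg_smul]; exact eq_neg_of_add_eq_zero_left h0
    set c := -lor x.1 y.1 with hc
    have h1 := y.2.1
    rw [hy, lor_smul_left, lor_smul_right, x.2.1] at h1
    have : c = 1 := by nlinarith
    rw [this, one_smul] at hy
    exact h (Subtype.ext hy.symm)
  have := lor_self_pos_of_orthogonal x ht hne
  simp only [lor_add_right, lor_smul_right, lor_add_left, lor_smul_left, x.2.1, y.2.1,
    lor_comm y.1 x.1] at this
  nlinarith

theorem one_le_neg_lor {n : ℕ} (x y : Hyp n) : 1 ≤ -lor x.1 y.1 := by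
  rcases eq_or_ne x y with rfl | h
  · rw [x.2.1]; norm_num
  · exact (one_lt_neg_lor h).le

/-! ### Distance, geodesics and rays -/

theorem hdist_pos {n : ℕ} {x y : Hyp n} (h : x ≠ y) : 0 < hdist x y :=
  Real.arcosh_pos (one_lt_neg_lor h)

theorem cosh_hdist {n : ℕ} (x y : Hyp n) : Real.cosh (hdist x y) = -lor x.1 y.1 :=
  Real.cosh_arcosh (one_le_neg_lor x y)

theorem lor_unitDir {n : ℕ} (x y : Hyp n) : lor x.1 (unitDir x y) = 0 := by
  rw [unitDir, lor_smul_right, lor_add_right, lor_smul_right, x.2.1]; ring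

theorem lor_unitDir_self {n : ℕ} {x y : Hyp n} (h : x ≠ y) :
    lor (unitDir x y) (unitDir x y) = 1 := by
  have hs := Real.sinh_pos_iff.2 (hdist_pos h)
  have hc := Real.cosh_sq (hdist x y)
  rw [cosh_hdist] at hc
  simp only [unitDir, lor_add_right, lor_smul_right, lor_add_left, lor_smul_left, x.2.1, y.2.1,
    lor_comm y.1 x.1]
  field_simp
  linarith

/-- The geodesic through `x` with unit velocity `u`. -/
noncomputable def geo {n : ℕ} (x : Hyp n) (u : Lorentz n) (hx : lor x.1 u = 0) (hu : lor u u = 1)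
    (t : ℝ) : Hyp n :=
  ⟨Real.cosh t • x.1 + Real.sinh t • u, by
    have h : lor (Real.cosh t • x.1 + Real.sinh t • u) (Real.cosh t • x.1 + Real.sinh t • u)
        = -1 := by
      simp only [lor_add_right, lor_smul_right, lor_add_left, lor_smul_left, x.2.1, hx, hu,
        lor_comm u x.1]
      linarith [Real.cosh_sq t]
    refine ⟨h, fst_pos_of_lor_neg x (by rw [h]; norm_num) ?_⟩
    rw [lor_add_right, lor_smul_right, lor_smul_right, hx, x.2.1]
    linarith [Real.cosh_pos t]⟩

theorem geo_coe {n : ℕ} (x : Hyp n) (u : Lorentz n) (hx : lor x.1 u = 0) (hu : lor u u = 1)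
    (t : ℝ) : (geo x u hx hu t).1 = Real.cosh t • x.1 + Real.sinh t • u := rfl

theorem contDiff_geo {n : ℕ} (x : Hyp n) (u : Lorentz n) (hx : lor x.1 u = 0) (hu : lor u u = 1) :
    ContDiff ℝ 1 fun t => (geo x u hx hu t).1 := by
  simp only [geo_coe]
  exact (Real.contDiff_cosh.smul contDiff_const).add (Real.contDiff_sinh.smul contDiff_const)

theorem continuous_geo {n : ℕ} (x : Hyp n) (u : Lorentz n) (hx : lor x.1 u = 0)
    (hu : lor u u = 1) : Continuous (geo x u hx hu) :=
  continuous_induced_rng.2 (contDiff_geo x u hx hu).continuous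

theorem hasDerivAt_geo {n : ℕ} (x : Hyp n) (u : Lorentz n) (hx : lor x.1 u = 0)
    (hu : lor u u = 1) (t : ℝ) :
    HasDerivAt (fun t => (geo x u hx hu t).1) (Real.sinh t • x.1 + Real.cosh t • u) t := by
  simp only [geo_coe]
  exact ((Real.hasDerivAt_cosh t).smul_const x.1).add ((Real.hasDerivAt_sinh t).smul_const u)

theorem geo_zero {n : ℕ} (x : Hyp n) (u : Lorentz n) (hx : lor x.1 u = 0) (hu : lor u u = 1) :
    geo x u hx hu 0 = x := Subtype.ext (by simp [geo_coe])

theorem hdist_geo {n : ℕ} (x : Hyp n) (u : Lorentz n) (hx : lor x.1 u = 0) (hu : lor u u = 1)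
    (s t : ℝ) : hdist (geo x u hx hu s) (geo x u hx hu t) = |t - s| := by
  have : -lor (geo x u hx hu s).1 (geo x u hx hu t).1 = Real.cosh |t - s| := by
    rw [Real.cosh_abs, Real.cosh_sub]
    simp only [geo_coe, lor_add_right, lor_smul_right, lor_add_left, lor_smul_left, x.2.1, hx, hu,
      lor_comm u x.1]
    ring
  rw [hdist, this, Real.arcosh_cosh (abs_nonneg _)]

theorem hnorm_smul {n : ℕ} (t : ℝ) (ξ : Lorentz n) : hnorm (t • ξ) = |t| * hnorm ξ := by
  rw [hnorm, lor_smul_left, lor_smul_right, ← mul_assoc, ← sq, Real.sqrt_mul (sq_nonneg t),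
    Real.sqrt_sq_eq_abs, hnorm]

theorem hexp_smul_unit {n : ℕ} (x : Hyp n) (u : Lorentz n) (hx : lor x.1 u = 0) (hu : lor u u = 1)
    (t : ℝ) : hexp x (t • u) = (geo x u hx hu t).1 := by
  have h1 : hnorm u = 1 := by rw [hnorm, hu, Real.sqrt_one]
  rw [hexp, hnorm_smul, h1, mul_one, Real.cosh_abs, geo_coe, smul_smul]
  congr 2
  rcases eq_or_ne t 0 with rfl | ht
  · simp
  · rcases abs_choice t with h | h <;> rw [h] <;> field_simp
    rw [Real.sinh_neg]; ring

theorem geo_unitDir {n : ℕ} {x y : Hyp n} (h : x ≠ y) :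
    geo x (unitDir x y) (lor_unitDir x y) (lor_unitDir_self h) (hdist x y) = y := by
  have hs := Real.sinh_pos_iff.2 (hdist_pos h)
  refine Subtype.ext ?_
  rw [geo_coe, cosh_hdist, unitDir, smul_smul, mul_inv_cancel₀ hs.ne', one_smul, neg_smul]
  abel

theorem hnorm_pos {n : ℕ} (x : Hyp n) {ξ : Lorentz n} (h : lor x.1 ξ = 0) (hne : ξ ≠ 0) :
    0 < hnorm ξ := Real.sqrt_pos.2 (lor_self_pos_of_orthogonal x h hne)

theorem hnorm_zero {n : ℕ} : hnorm (0 : Lorentz n) = 0 := by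
  rw [hnorm, lor_zero_left, Real.sqrt_zero]

theorem exists_eq_smul_unit {n : ℕ} (x : Hyp n) {ξ : Lorentz n} (h : lor x.1 ξ = 0)
    (hne : ξ ≠ 0) : ∃ u : Lorentz n, lor x.1 u = 0 ∧ lor u u = 1 ∧ ξ = hnorm ξ • u := by
  have hp := hnorm_pos x h hne
  refine ⟨(hnorm ξ)⁻¹ • ξ, by rw [lor_smul_right, h, mul_zero], ?_, ?_⟩
  · rw [lor_smul_left, lor_smul_right]
    have : hnorm ξ ^ 2 = lor ξ ξ := Real.sq_sqrt (lor_self_nonneg_of_orthogonal x h)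
    rw [← this]
    field_simp
  · rw [smul_smul, mul_inv_cancel₀ hp.ne', one_smul]

theorem ray_smul {n : ℕ} (x : Hyp n) (ξ : Lorentz n) {r : ℝ} (hr : 0 < r) :
    ray x (r • ξ) = ray x ξ := by
  ext z
  constructor
  · rintro ⟨t, ht, hz⟩
    exact ⟨t * r, mul_pos ht hr, by rw [hz, smul_smul]⟩
  · rintro ⟨t, ht, hz⟩
    exact ⟨t / r, div_pos ht hr, by rw [hz, smul_smul, div_mul_cancel₀ t hr.ne']⟩

theorem ray_zero {n : ℕ} (x : Hyp n) : ray x 0 = {x} := by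
  ext z
  simp only [ray, smul_zero, hexp, hnorm_zero, Real.cosh_zero, one_smul, add_zero,
    Set.mem_ofPred_eq, Set.mem_singleton_iff, Subtype.ext_iff]
  exact ⟨fun ⟨_, _, h⟩ => h, fun h => ⟨1, one_pos, h⟩⟩

theorem mem_ray_unit {n : ℕ} (x : Hyp n) (u : Lorentz n) (hx : lor x.1 u = 0) (hu : lor u u = 1)
    (z : Hyp n) : z ∈ ray x u ↔ ∃ t, 0 < t ∧ z = geo x u hx hu t := by
  simp only [ray, hexp_smul_unit x u hx hu, Set.mem_ofPred_eq, Subtype.ext_iff]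

/-- The form is positive semidefinite on tangent spaces, so the Riemannian norm is subadditive. -/
theorem hnorm_add_le {n : ℕ} (x : Hyp n) {a b : Lorentz n} (ha : lor x.1 a = 0)
    (hb : lor x.1 b = 0) : hnorm (a + b) ≤ hnorm a + hnorm b := by
  have ha0 := lor_self_nonneg_of_orthogonal x ha
  have hb0 := lor_self_nonneg_of_orthogonal x hb
  have hsa : hnorm a ^ 2 = lor a a := Real.sq_sqrt ha0
  have hsb : hnorm b ^ 2 = lor b b := Real.sq_sqrt hb0
  have hcs : lor a b ≤ hnorm a * hnorm b := by
    rcases eq_or_ne a 0 with rfl | hane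
    · rw [lor_zero_left, hnorm_zero, zero_mul]
    rcases eq_or_ne b 0 with rfl | hbne
    · rw [lor_zero_right, hnorm_zero, mul_zero]
    have h1 := hnorm_pos x ha hane
    have h2 := hnorm_pos x hb hbne
    have := lor_self_nonneg_of_orthogonal x (ξ := hnorm b • a - hnorm a • b) (by
      rw [lor_sub_right, lor_smul_right, lor_smul_right, ha, hb]; ring)
    simp only [lor_sub_right, lor_smul_right, lor_sub_left, lor_smul_left, lor_comm b a,
      ← hsa, ← hsb] at this
    have h3 := mul_pos h1 h2
    nlinarith
  refine (Real.sqrt_le_left (add_nonneg (Real.sqrt_nonneg _) (Real.sqrt_nonneg _))).2 ?_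
  change _ ≤ (hnorm a + hnorm b) ^ 2
  rw [lor_add_left, lor_add_right, lor_add_right, lor_comm b a]
  nlinarith

theorem convexOn_hnorm {n : ℕ} (x : Hyp n) :
    ConvexOn ℝ (tangent x : Set (Lorentz n)) hnorm := by
  refine ⟨(tangent x).convex, fun a ha b hb s t hs ht _ => ?_⟩
  refine (hnorm_add_le x ((tangent x).smul_mem s ha) ((tangent x).smul_mem t hb)).trans ?_
  rw [hnorm_smul, hnorm_smul, abs_of_nonneg hs, abs_of_nonneg ht, smul_eq_mul, smul_eq_mul]

/-- Differentiate the constraint `lor c c = -1`. -/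
theorem lor_eq_zero_of_hasDerivAt {n : ℕ} {c : ℝ → Hyp n} {ξ : Lorentz n} {t : ℝ}
    (h : HasDerivAt (fun s => (c s).1) ξ t) : lor (c t).1 ξ = 0 := by
  have h1 : HasDerivAt (fun s => lor (c s).1 (c s).1) (2 * lor (c t).1 ξ) t := by
    have hf : HasDerivAt (fun s => (c s).1.1) ξ.1 t :=
      (ContinuousLinearMap.fst ℝ ℝ (EuclideanSpace ℝ (Fin n))).hasFDerivAt.comp_hasDerivAt t h
    have hs : HasDerivAt (fun s => (c s).1.2) ξ.2 t :=
      (ContinuousLinearMap.snd ℝ ℝ (EuclideanSpace ℝ (Fin n))).hasFDerivAt.comp_hasDerivAt t h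
    refine ((hs.inner ℝ hs).sub (hf.mul hf)).congr_deriv ?_
    simp only [lor, real_inner_comm ξ.2]
    ring
  have h2 : (fun s => lor (c s).1 (c s).1) = fun _ => (-1 : ℝ) := funext fun s => (c s).2.1
  rw [h2] at h1
  have := h1.unique (hasDerivAt_const t (-1 : ℝ))
  linarith

/-! ### Distance to a hyperplane and its gradient -/

/-- The outer unit normals of the supporting hyperplanes of `Ω`. -/
def unitNormals {n : ℕ} (Ω : Set (Hyp n)) : Set (Lorentz n) :=
  {v | lor v v = 1 ∧ (∀ z ∈ Ω, lor z.1 v < 0) ∧ ∃ b ∈ frontier Ω, lor b.1 v = 0}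

theorem exists_unitNormal_smul {n : ℕ} {Ω : Set (Hyp n)} {v : Lorentz n} (hv : 0 < lor v v)
    (hΩ : ∀ z ∈ Ω, lor z.1 v < 0) {b : Hyp n} (hb : b ∈ frontier Ω) (hbv : lor b.1 v = 0) :
    ∃ c : ℝ, 0 < c ∧ c • v ∈ unitNormals Ω := by
  have hs := Real.sqrt_pos.2 hv
  refine ⟨(√(lor v v))⁻¹, inv_pos.2 hs, ?_, fun z hz => ?_, b, hb, ?_⟩
  · rw [lor_smul_left, lor_smul_right]
    have := Real.sq_sqrt hv.le
    field_simp
    exact this.symm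
  · rw [lor_smul_right]
    exact mul_neg_of_pos_of_neg (inv_pos.2 hs) (hΩ z hz)
  · rw [lor_smul_right, hbv, mul_zero]

theorem isSupporting_iff {n : ℕ} (Ω π : Set (Hyp n)) :
    IsSupporting Ω π ↔ ∃ v ∈ unitNormals Ω, π = {z | lor z.1 v = 0} := by
  constructor
  · rintro ⟨v, hv, rfl, hΩ, b, hb, hbv⟩
    obtain ⟨c, hc, hcv⟩ := exists_unitNormal_smul hv hΩ hb hbv
    refine ⟨c • v, hcv, ?_⟩
    ext z
    simp only [Set.mem_ofPred_eq, lor_smul_right, mul_eq_zero, hc.ne', false_or]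
  · rintro ⟨v, ⟨hv, hΩ, b, hb, hbv⟩, rfl⟩
    exact ⟨v, by rw [hv]; exact one_pos, rfl, hΩ, b, hb, hbv⟩

/-- Write `z = k u + s v` with `s = lor z v` and `k = √(1 + s²)`; then `u` is the foot of the
perpendicular. For `w` in the hyperplane, `-lor z w = k (-lor u w) ≥ k = cosh (arsinh |s|)`, with
equality at `w = u`. -/
theorem setDist_hyperplane {n : ℕ} (z : Hyp n) {v : Lorentz n} (hv : lor v v = 1) :
    setDist z {w | lor w.1 v = 0} = Real.arsinh |lor z.1 v| := by
  set s := lor z.1 v with hs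
  have hk : 0 < √(1 + s ^ 2) := Real.sqrt_pos.2 (by positivity)
  have hk2 : √(1 + s ^ 2) ^ 2 = 1 + s ^ 2 := Real.sq_sqrt (by positivity)
  set k := √(1 + s ^ 2)
  have hac : Real.arcosh k = Real.arsinh |s| := by
    rw [← Real.arcosh_cosh (Real.arsinh_nonneg_iff.2 (abs_nonneg s)), Real.cosh_arsinh, sq_abs]
  let u : Lorentz n := k⁻¹ • (z.1 - s • v)
  have huu : lor u u = -1 := by
    simp only [u, lor_smul_left, lor_smul_right, lor_sub_left, lor_sub_right, z.2.1, hv, ← hs,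
      lor_comm v z.1]
    field_simp
    linarith
  have hzu : lor z.1 u = -k := by
    simp only [u, lor_smul_right, lor_sub_right, z.2.1, ← hs]
    field_simp
    linarith
  let f : Hyp n := ⟨u, huu, fst_pos_of_lor_neg z (by rw [huu]; norm_num) (by rw [hzu]; linarith)⟩
  have hleast : IsLeast (hdist z '' {w | lor w.1 v = 0}) (Real.arsinh |s|) := by
    refine ⟨⟨f, ?_, ?_⟩, ?_⟩
    · simp only [Set.mem_ofPred_eq, f, u, lor_smul_left, lor_sub_left, hv, ← hs]
      ring
    · rw [hdist, hzu, neg_neg, hac]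
    · rintro _ ⟨w, hw, rfl⟩
      have h1 := one_le_neg_lor f w
      have h2 : z.1 = k • u + s • v := by
        simp only [u, smul_smul, mul_inv_cancel₀ hk.ne', one_smul, sub_add_cancel]
      have h3 : lor z.1 w.1 = k * lor f.1 w.1 := by
        rw [h2, lor_add_left, lor_smul_left, lor_smul_left s, lor_comm v, hw, mul_zero, add_zero]
      rw [← hac, hdist, Real.arcosh_le_arcosh hk (by linarith [one_le_neg_lor z w]), h3]
      nlinarith
  exact hleast.csInf_eq

/-- It is enough to test both gradients on the geodesic leaving `x` in the direction `g - g'`. -/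
theorem isGradient_unique {n : ℕ} {f : Hyp n → ℝ} {x : Hyp n} {g g' : Lorentz n}
    (h : IsGradient f x g) (h' : IsGradient f x g') : g = g' := by
  by_contra hne
  obtain ⟨u, hx, hu, hg⟩ := exists_eq_smul_unit x (ξ := g - g')
    ((tangent x).sub_mem h.1 h'.1) (sub_ne_zero.2 hne)
  have hp := hnorm_pos x (ξ := g - g') ((tangent x).sub_mem h.1 h'.1) (sub_ne_zero.2 hne)
  have hd := hasDerivAt_geo x u hx hu 0
  simp only [Real.sinh_zero, zero_smul, Real.cosh_zero, one_smul, zero_add] at hd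
  have h1 := (h.2 _ u (geo_zero x u hx hu) hd).unique (h'.2 _ u (geo_zero x u hx hu) hd)
  have h2 : lor (g - g') u = hnorm (g - g') := by
    conv_lhs => rw [hg]
    rw [lor_smul_left, hu, mul_one]
  rw [lor_sub_left] at h2
  linarith

/-- On the negative side the distance is `arsinh (-lor · v)`, so this is the chain rule, with `v +
lor x v • x` the tangential part of `v`. -/
theorem isGradient_setDist_hyperplane {n : ℕ} (x : Hyp n) {v : Lorentz n} (hv : lor v v = 1)
    (hxv : lor x.1 v < 0) :
    IsGradient (fun z => setDist z {w | lor w.1 v = 0}) x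
      (-((√(1 + lor x.1 v ^ 2))⁻¹ • (v + lor x.1 v • x.1))) := by
  refine ⟨?_, fun c ξ hc hd => ?_⟩
  · change lor x.1 _ = 0
    rw [lor_neg_right, lor_smul_right, lor_add_right, lor_smul_right, x.2.1]
    ring
  · have hξ : lor x.1 ξ = 0 := hc ▸ lor_eq_zero_of_hasDerivAt hd
    have hl : HasDerivAt (fun t => lor (c t).1 v) (lor ξ v) 0 := by
      have := (lorL v).hasFDerivAt.comp_hasDerivAt (0 : ℝ) hd
      simpa only [Function.comp_def, lorL_apply] using this
    have hev : ∀ᶠ t in nhds (0 : ℝ), lor (c t).1 v < 0 :=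
      hl.continuousAt.eventually_lt continuousAt_const (by rw [hc]; exact hxv)
    have ha := (Real.hasDerivAt_arsinh (-lor (c 0).1 v)).comp (0 : ℝ) hl.neg
    refine (ha.congr_of_eventuallyEq ?_).congr_deriv ?_
    · filter_upwards [hev] with t ht
      rw [setDist_hyperplane _ hv, abs_of_neg ht]
      rfl
    · rw [hc, lor_neg_left, lor_smul_left, lor_add_left, lor_smul_left, hξ, neg_sq, lor_comm v]
      ring

/-- The tangential part of `v` has square `1 + (lor x v)²`, so the gradient already has length one
and the scaling factor in `IsEta` must be `1`. -/
theorem isEta_hyperplane_iff {n : ℕ} (x : Hyp n) {v : Lorentz n} (hv : lor v v = 1)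
    (hxv : lor x.1 v < 0) (η : Lorentz n) :
    IsEta {w | lor w.1 v = 0} x η ↔
      η = (√(1 + lor x.1 v ^ 2))⁻¹ • (v + lor x.1 v • x.1) := by
  have hk : 0 < √(1 + lor x.1 v ^ 2) := Real.sqrt_pos.2 (by positivity)
  have hk2 : √(1 + lor x.1 v ^ 2) ^ 2 = 1 + lor x.1 v ^ 2 := Real.sq_sqrt (by positivity)
  have hg := isGradient_setDist_hyperplane x hv hxv
  set k := √(1 + lor x.1 v ^ 2)
  set e := k⁻¹ • (v + lor x.1 v • x.1) with he
  have hee : lor e e = 1 := by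
    simp only [he, lor_smul_left, lor_smul_right, lor_add_left, lor_add_right, x.2.1, hv,
      lor_comm v x.1]
    field_simp
    linarith
  constructor
  · rintro ⟨-, hη, c, hc, hgr⟩
    have h1 : c • η = e := neg_injective (isGradient_unique hgr hg)
    rw [← h1, lor_smul_left, lor_smul_right, hη] at hee
    have : c = 1 := by nlinarith
    rw [← h1, this, one_smul]
  · rintro rfl
    refine ⟨?_, hee, 1, one_pos, by rwa [one_smul]⟩
    have := (tangent x).neg_mem hg.1
    rwa [neg_neg] at this

/-! ### The Minkowski functionals in terms of slopes -/

/-- The slope at `x` in direction `ξ` of minus the logarithm of `-lor · v`. -/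
noncomputable def slope {n : ℕ} (x ξ v : Lorentz n) : ℝ := lor v ξ / -lor x v

/-- With `s = lor x v`, the factor `√(1 + s²)` in `coth d(x, π) = √(1 + s²) / (-s)` cancels the
normalization of `η`. -/
theorem minkowskiSet_eq {n : ℕ} {Ω : Set (Hyp n)} {x : Hyp n} (hx : x ∈ Ω) {ξ : Lorentz n}
    (hξ : lor x.1 ξ = 0) : minkowskiSet Ω x ξ = slope x.1 ξ '' unitNormals Ω := by
  have key : ∀ v ∈ unitNormals Ω,
      Real.cosh (setDist x {w | lor w.1 v = 0}) / Real.sinh (setDist x {w | lor w.1 v = 0}) *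
        lor ((√(1 + lor x.1 v ^ 2))⁻¹ • (v + lor x.1 v • x.1)) ξ = slope x.1 ξ v := by
    intro v hv
    have hneg := hv.2.1 x hx
    have hk : 0 < √(1 + lor x.1 v ^ 2) := Real.sqrt_pos.2 (by positivity)
    rw [setDist_hyperplane x hv.1, Real.cosh_arsinh, Real.sinh_arsinh, sq_abs, abs_of_neg hneg,
      lor_smul_left, lor_add_left, lor_smul_left, hξ, slope]
    field_simp
    ring
  ext r
  constructor
  · rintro ⟨π, η, hπ, hη, rfl⟩
    obtain ⟨v, hv, rfl⟩ := (isSupporting_iff Ω π).1 hπ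
    rw [isEta_hyperplane_iff x hv.1 (hv.2.1 x hx)] at hη
    exact ⟨v, hv, by rw [hη, key v hv]⟩
  · rintro ⟨v, hv, rfl⟩
    exact ⟨_, _, (isSupporting_iff Ω _).2 ⟨v, hv, rfl⟩,
      (isEta_hyperplane_iff x hv.1 (hv.2.1 x hx) _).2 rfl, (key v hv).symm⟩

/-- For unit `u` with slope `q`, the geodesic meets the hyperplane at time `t` iff `cosh t = q sinh
t`. A solution `t > 0` exists iff `q > 1`, and then `coth t = q`; otherwise the convention `coth ∞ =
1` supplies the other branch of the maximum. -/
theorem cothT_hyperplane {n : ℕ} {x : Hyp n} {v ξ : Lorentz n} (hxv : lor x.1 v < 0)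
    (hξ : lor x.1 ξ = 0) :
    cothT x ξ {w | lor w.1 v = 0} * hnorm ξ = max (hnorm ξ) (slope x.1 ξ v) := by
  rcases eq_or_ne ξ 0 with rfl | hne
  · simp [hnorm_zero, slope, lor_zero_right]
  have hr := hnorm_pos x hξ hne
  obtain ⟨u, hxu, hu, hξu⟩ := exists_eq_smul_unit x hξ hne
  have hray : ray x ξ = ray x u := by rw [hξu, ray_smul x u hr]
  have hslope : slope x.1 ξ v = hnorm ξ * slope x.1 u v := by
    conv_lhs => rw [hξu]
    rw [slope, lor_smul_right, slope, mul_div_assoc]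
  have hmem : ∀ t, lor (geo x u hxu hu t).1 v = 0 ↔
      Real.cosh t = slope x.1 u v * Real.sinh t := by
    intro t
    rw [geo_coe, lor_add_left, lor_smul_left, lor_smul_left, slope, lor_comm u v]
    rw [div_mul_eq_mul_div, eq_div_iff (neg_pos.2 hxv).ne']
    constructor <;> intro h <;> linarith
  rw [hslope, cothT, hray]
  split_ifs with h
  · obtain ⟨z, hz, hzr⟩ := h
    obtain ⟨t, ht, rfl⟩ := (mem_ray_unit x u hxu hu z).1 hzr
    have ht1 := (hmem t).1 hz
    have hst := Real.sinh_pos_iff.2 ht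
    have him : hdist x '' ({w | lor w.1 v = 0} ∩ ray x u) = {t} := by
      have hd : ∀ s, 0 < s → hdist x (geo x u hxu hu s) = s := by
        intro s hs
        have := hdist_geo x u hxu hu 0 s
        rwa [geo_zero, sub_zero, abs_of_pos hs] at this
      refine Set.Subset.antisymm ?_ ?_
      · rintro _ ⟨w, ⟨hw, hwr⟩, rfl⟩
        obtain ⟨s, hs, rfl⟩ := (mem_ray_unit x u hxu hu w).1 hwr
        rw [hd s hs, Set.mem_singleton_iff]
        have hs1 := (hmem s).1 hw
        have : Real.sinh (s - t) = 0 := by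
          rw [Real.sinh_sub, ht1, hs1]; ring
        linarith [Real.sinh_eq_zero.1 this]
      · rintro _ rfl
        exact ⟨_, ⟨hz, hzr⟩, hd _ ht⟩
    have hcoth : Real.cosh t / Real.sinh t = slope x.1 u v := by
      rw [ht1]; field_simp
    have h1 : 1 < slope x.1 u v := by
      rw [← hcoth, one_lt_div hst]
      exact Real.sinh_lt_cosh t
    rw [setDist, him, csInf_singleton, hcoth, max_eq_right (by nlinarith), mul_comm]
  · have h1 : slope x.1 u v ≤ 1 := by
      by_contra hc
      push Not at hc
      set q := slope x.1 u v
      have hq : 0 < q := by linarith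
      have hq1 : q⁻¹ < 1 := inv_lt_one_of_one_lt₀ hc
      have hqm : q⁻¹ ∈ Set.Ioo (-1 : ℝ) 1 := ⟨by linarith [inv_pos.2 hq], hq1⟩
      -- The meeting time solves `tanh t = 1 / q`.
      have htp : 0 < Real.artanh q⁻¹ := Real.artanh_pos ⟨inv_pos.2 hq, hq1⟩
      refine h ⟨geo x u hxu hu (Real.artanh q⁻¹), (hmem _).2 ?_,
        (mem_ray_unit x u hxu hu _).2 ⟨_, htp, rfl⟩⟩
      have := Real.tanh_artanh hqm
      rw [Real.tanh_eq_sinh_div_cosh, div_eq_iff (Real.cosh_pos _).ne'] at this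
      rw [this]
      field_simp
    rw [max_eq_left (by nlinarith), one_mul]

theorem rayMinkowskiSet_eq {n : ℕ} {Ω : Set (Hyp n)} {x : Hyp n} (hx : x ∈ Ω) {ξ : Lorentz n}
    (hξ : lor x.1 ξ = 0) :
    rayMinkowskiSet Ω x ξ = (fun v => max (hnorm ξ) (slope x.1 ξ v)) '' unitNormals Ω := by
  ext r
  constructor
  · rintro ⟨π, hπ, rfl⟩
    obtain ⟨v, hv, rfl⟩ := (isSupporting_iff Ω π).1 hπ
    exact ⟨v, hv, (cothT_hyperplane (hv.2.1 x hx) hξ).symm⟩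
  · rintro ⟨v, hv, rfl⟩
    exact ⟨_, (isSupporting_iff Ω _).2 ⟨v, hv, rfl⟩, (cothT_hyperplane (hv.2.1 x hx) hξ).symm⟩

/-! ### The cone over `Ω` and supporting hyperplanes -/

/-- The open convex cone spanned by `Ω` in Lorentzian space. -/
def coneOver {n : ℕ} (Ω : Set (Hyp n)) : Set (Lorentz n) :=
  {u | ∃ s : ℝ, 0 < s ∧ ∃ z ∈ Ω, u = s • z.1}

theorem mem_coneOver {n : ℕ} {Ω : Set (Hyp n)} {x : Hyp n} (hx : x ∈ Ω) : x.1 ∈ coneOver Ω :=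
  ⟨1, one_pos, x, hx, (one_smul ℝ _).symm⟩

theorem coe_mem_coneOver_iff {n : ℕ} {Ω : Set (Hyp n)} {x : Hyp n} :
    x.1 ∈ coneOver Ω ↔ x ∈ Ω := by
  refine ⟨?_, mem_coneOver⟩
  rintro ⟨s, hs, z, hz, hxz⟩
  have h := x.2.1
  rw [hxz, lor_smul_left, lor_smul_right, z.2.1] at h
  have : s = 1 := by nlinarith
  rw [this, one_smul] at hxz
  rwa [Subtype.ext hxz]

/-- The cone is the preimage of an open set under the radial projection `u ↦ u / √(-lor u u)`, which
is continuous on the open future cone. -/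
theorem isOpen_coneOver {n : ℕ} {Ω : Set (Hyp n)} (hΩ : IsOpen Ω) : IsOpen (coneOver Ω) := by
  obtain ⟨U, hU, rfl⟩ := isOpen_induced_iff.1 hΩ
  let T : Set (Lorentz n) := {u : Lorentz n | lor u u < 0} ∩ {u : Lorentz n | 0 < u.1}
  have h1 : IsOpen {u : Lorentz n | lor u u < 0} :=
    isOpen_lt continuous_lor_self continuous_const
  have h2 : IsOpen {u : Lorentz n | 0 < u.1} := isOpen_lt continuous_const continuous_fst
  have hT : IsOpen T := h1.inter h2
  let g : Lorentz n → Lorentz n := fun u => (√(-lor u u))⁻¹ • u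
  have hinv : ContinuousOn (fun u : Lorentz n => (√(-lor u u))⁻¹) T :=
    (continuous_lor_self.neg.sqrt).continuousOn.inv₀ fun u hu =>
      (Real.sqrt_pos.2 (neg_pos.2 hu.1)).ne'
  have hg : ContinuousOn g T := hinv.smul continuousOn_id
  convert hg.isOpen_inter_preimage hT hU using 1
  ext u
  constructor
  · rintro ⟨s, hs, z, hz, rfl⟩
    have h : -lor (s • z.1) (s • z.1) = s ^ 2 := by
      rw [lor_smul_left, lor_smul_right, z.2.1]; ring
    refine ⟨⟨?_, mul_pos hs z.2.2⟩, ?_⟩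
    · have : 0 < s ^ 2 := by positivity
      change lor (s • z.1) (s • z.1) < 0
      linarith
    · simp only [g, Set.mem_preimage, h, Real.sqrt_sq hs.le, smul_smul, inv_mul_cancel₀ hs.ne',
        one_smul]
      exact hz
  · rintro ⟨⟨h1, h2⟩, h3⟩
    have h1' : 0 < -lor u u := neg_pos.2 h1
    have hs := Real.sqrt_pos.2 h1'
    refine ⟨√(-lor u u), hs, ⟨g u, ?_, mul_pos (inv_pos.2 hs) h2⟩, h3, ?_⟩
    · have := Real.sq_sqrt h1'.le
      simp only [g, lor_smul_left, lor_smul_right]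
      field_simp
      linarith
    · simp only [g, smul_smul, mul_inv_cancel₀ hs.ne', one_smul]

/-- In the coordinates `sinh t`, `sinh (d - t)`, points of the segment are combinations of the
endpoints. -/
theorem geo_combination {n : ℕ} (x : Hyp n) (u : Lorentz n) (hx : lor x.1 u = 0)
    (hu : lor u u = 1) (d t : ℝ) :
    Real.sinh d • (geo x u hx hu t).1 =
      Real.sinh (d - t) • x.1 + Real.sinh t • (geo x u hx hu d).1 := by
  simp only [geo_coe, Real.sinh_sub]
  module

theorem convex_coneOver {n : ℕ} {Ω : Set (Hyp n)} (hΩ : HConvex Ω) : Convex ℝ (coneOver Ω) := by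
  have hadd : ∀ u ∈ coneOver Ω, ∀ w ∈ coneOver Ω, u + w ∈ coneOver Ω := by
    rintro _ ⟨s, hs, x, hx, rfl⟩ _ ⟨t, ht, y, hy, rfl⟩
    rcases eq_or_ne x y with rfl | hne
    · exact ⟨s + t, add_pos hs ht, x, hx, (add_smul _ _ _).symm⟩
    have hd := hdist_pos hne
    set d := hdist x y
    -- The point of the segment proportional to `s x + t y` sits where `sinh (d - τ) : sinh τ = s :
    -- t`, by `geo_combination`; the intermediate value theorem finds it.
    obtain ⟨τ, hτ, hτ0⟩ : ∃ τ ∈ Set.Icc 0 d, s * Real.sinh τ - t * Real.sinh (d - τ) = 0 := by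
      have hc : ContinuousOn (fun τ => s * Real.sinh τ - t * Real.sinh (d - τ)) (Set.Icc 0 d) := by
        fun_prop
      have := intermediate_value_Icc hd.le hc
      refine this ⟨?_, ?_⟩
      · simp only [Real.sinh_zero, mul_zero, sub_zero, zero_sub, Left.neg_nonpos_iff]
        exact mul_nonneg ht.le (Real.sinh_nonneg_iff.2 hd.le)
      · simp only [sub_self, Real.sinh_zero, mul_zero, sub_zero]
        exact mul_nonneg hs.le (Real.sinh_nonneg_iff.2 hd.le)
    have hτp : 0 < τ := by
      rcases hτ.1.eq_or_lt with h | h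
      · rw [← h, Real.sinh_zero, sub_zero] at hτ0
        nlinarith [Real.sinh_pos_iff.2 hd]
      · exact h
    have hsτ := Real.sinh_pos_iff.2 hτp
    have hsd := Real.sinh_pos_iff.2 hd
    have hux := lor_unitDir x y
    have huu := lor_unitDir_self hne
    refine ⟨t / Real.sinh τ * Real.sinh d, by positivity, geo x (unitDir x y) hux huu τ,
      hΩ x hx y hy ⟨τ, hτ.1, hτ.2, (hexp_smul_unit x _ hux huu τ).symm⟩, ?_⟩
    rw [mul_smul, geo_combination x _ hux huu d, geo_unitDir hne, smul_add, smul_smul, smul_smul]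
    congr 2
    · field_simp
      linarith
    · field_simp
  intro u hu w hw a b ha hb hab
  have hsmul : ∀ (c : ℝ), 0 < c → ∀ u ∈ coneOver Ω, c • u ∈ coneOver Ω := by
    rintro c hc _ ⟨s, hs, z, hz, rfl⟩
    exact ⟨c * s, mul_pos hc hs, z, hz, smul_smul _ _ _⟩
  rcases ha.eq_or_lt with rfl | ha
  · rw [zero_add] at hab
    rwa [hab, zero_smul, zero_add, one_smul]
  rcases hb.eq_or_lt with rfl | hb
  · rw [add_zero] at hab
    rwa [hab, zero_smul, add_zero, one_smul]
  exact hadd _ (hsmul a ha u hu) _ (hsmul b hb w hw)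

theorem lor_neg_of_mem_coneOver {n : ℕ} {Ω : Set (Hyp n)} {u v : Lorentz n} (hu : u ∈ coneOver Ω)
    (hv : v ∈ unitNormals Ω) : lor u v < 0 := by
  obtain ⟨s, hs, z, hz, rfl⟩ := hu
  rw [lor_smul_left]
  exact mul_neg_of_pos_of_neg hs (hv.2.1 z hz)

theorem lor_nonpos_of_mem_closure {n : ℕ} {Ω : Set (Hyp n)} {b : Hyp n} (hb : b ∈ closure Ω)
    {v : Lorentz n} (hv : ∀ z ∈ Ω, lor z.1 v ≤ 0) : lor b.1 v ≤ 0 := by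
  have hc : Continuous fun z : Hyp n => lor z.1 v := by
    simp only [← lorL_apply]
    exact (lorL v).continuous.comp continuous_subtype_val
  exact closure_minimal (fun z hz => hv z hz) (isClosed_le hc continuous_const) hb

/-- Through every boundary point passes a supporting hyperplane. -/
theorem exists_unitNormal {n : ℕ} {Ω : Set (Hyp n)} (hopen : IsOpen Ω) (hconv : HConvex Ω)
    {b : Hyp n} (hb : b ∈ frontier Ω) : ∃ v ∈ unitNormals Ω, lor b.1 v = 0 := by
  have hbΩ : b ∉ Ω := fun h => (hopen.frontier_eq ▸ hb).2 h
  obtain ⟨f, hf⟩ := geometric_hahn_banach_open_point (convex_coneOver hconv)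
    (isOpen_coneOver hopen) (mt coe_mem_coneOver_iff.1 hbΩ)
  obtain ⟨v, hv⟩ := exists_eq_lor f
  simp only [hv] at hf
  have hneg : ∀ z ∈ Ω, lor z.1 v ≤ 0 := by
    intro z hz
    by_contra hc
    push Not at hc
    -- Rescaling `z` inside the cone makes the functional equal to `|lor b v| + 1`, above its bound
    -- `lor b v`.
    have := hf (((|lor b.1 v| + 1) / lor z.1 v) • z.1) ⟨_, by positivity, z, hz, rfl⟩
    rw [lor_smul_left, div_mul_cancel₀ _ hc.ne'] at this
    linarith [le_abs_self (lor b.1 v)]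
  have hb0 : lor b.1 v ≤ 0 := lor_nonpos_of_mem_closure hb.1 hneg
  have hb1 : 0 ≤ lor b.1 v := by
    by_contra hc
    push Not at hc
    obtain ⟨z, hz⟩ : Ω.Nonempty := closure_nonempty_iff.1 ⟨b, hb.1⟩
    have hz' : lor z.1 v < 0 := lt_trans (hf _ (mem_coneOver hz)) hc
    -- Here `z` is rescaled so that the functional equals `lor b v`, against the strict separation.
    have := hf ((lor b.1 v / lor z.1 v) • z.1) ⟨_, div_pos_of_neg_of_neg hc hz', z, hz, rfl⟩
    rw [lor_smul_left, div_mul_cancel₀ _ hz'.ne] at this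
    exact lt_irrefl _ this
  have hbv := le_antisymm hb0 hb1
  have hneg' : ∀ z ∈ Ω, lor z.1 v < 0 := fun z hz => (hf _ (mem_coneOver hz)).trans_eq hbv
  have hv0 : v ≠ 0 := by
    rintro rfl
    obtain ⟨z, hz⟩ : Ω.Nonempty := closure_nonempty_iff.1 ⟨b, hb.1⟩
    have := hneg' z hz
    rw [lor_zero_right] at this
    exact lt_irrefl _ this
  -- Being orthogonal to the point `b`, the vector `v` is spacelike and can be normalized.
  obtain ⟨c, -, hcv⟩ := exists_unitNormal_smul (lor_self_pos_of_orthogonal b hbv hv0) hneg' hb hbv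
  exact ⟨c • v, hcv, by rw [lor_smul_right, hbv, mul_zero]⟩

/-! ### Bounds uniform in the hyperplane, and continuity -/

/-- The functionals given by supporting hyperplanes are locally uniformly comparable. -/
theorem exists_abs_lor_mul_le {n : ℕ} {Ω : Set (Hyp n)} (hopen : IsOpen Ω) {x : Lorentz n}
    (hx : x ∈ coneOver Ω) : ∃ δ : ℝ, 0 < δ ∧ Metric.ball x δ ⊆ coneOver Ω ∧
      ∀ y ∈ Metric.ball x δ, ∀ v ∈ unitNormals Ω, ∀ ζ : Lorentz n,
        |lor ζ v| * δ ≤ ‖ζ‖ * -lor y v := by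
  obtain ⟨ε, hε, hball⟩ := Metric.isOpen_iff.1 (isOpen_coneOver hopen) x hx
  refine ⟨ε / 2, half_pos hε, (Metric.ball_subset_ball (by linarith)).trans hball,
    fun y hy v hv ζ => ?_⟩
  have main : ∀ ζ : Lorentz n, lor ζ v * (ε / 2) ≤ ‖ζ‖ * -lor y v := by
    intro ζ
    rcases eq_or_ne ζ 0 with rfl | hne
    · rw [lor_zero_left, norm_zero, zero_mul, zero_mul]
    have hζ := norm_pos_iff.2 hne
    -- Moving from `y` by `ε / 2` towards `ζ` stays in the cone, where pairing with `v` is negative.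
    have hmem : y + (ε / 2 / ‖ζ‖) • ζ ∈ coneOver Ω := by
      refine hball (Metric.mem_ball.2 ?_)
      calc dist (y + (ε / 2 / ‖ζ‖) • ζ) x ≤ dist (y + (ε / 2 / ‖ζ‖) • ζ) y + dist y x :=
            dist_triangle _ _ _
        _ < ε / 2 + ε / 2 := by
            refine add_lt_add_of_le_of_lt ?_ hy
            rw [dist_eq_norm, add_sub_cancel_left, norm_smul, Real.norm_eq_abs,
              abs_of_pos (by positivity), div_mul_cancel₀ _ hζ.ne']
        _ = ε := add_halves ε
    have := lor_neg_of_mem_coneOver hmem hv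
    rw [lor_add_left, lor_smul_left] at this
    have h2 : ε / 2 / ‖ζ‖ * lor ζ v < -lor y v := by linarith
    rw [div_mul_eq_mul_div, div_lt_iff₀ hζ] at h2
    linarith
  rcases abs_choice (lor ζ v) with h | h <;> rw [h]
  · exact main ζ
  · have := main (-ζ)
    rwa [lor_neg_left, norm_neg] at this

/-- The supremum of the slopes over all supporting hyperplanes. -/
noncomputable def slopeSup {n : ℕ} (Ω : Set (Hyp n)) (x ξ : Lorentz n) : ℝ :=
  sSup (slope x ξ '' unitNormals Ω)

theorem bddAbove_slope {n : ℕ} {Ω : Set (Hyp n)} (hopen : IsOpen Ω) {x : Lorentz n}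
    (hx : x ∈ coneOver Ω) (ξ : Lorentz n) : BddAbove (slope x ξ '' unitNormals Ω) := by
  obtain ⟨δ, hδ, -, h⟩ := exists_abs_lor_mul_le hopen hx
  refine ⟨‖ξ‖ / δ, ?_⟩
  rintro _ ⟨v, hv, rfl⟩
  have h1 := h x (Metric.mem_ball_self hδ) v hv ξ
  have h2 := lor_neg_of_mem_coneOver hx hv
  rw [slope, div_le_div_iff₀ (neg_pos.2 h2) hδ, lor_comm v]
  exact le_trans (mul_le_mul_of_nonneg_right (le_abs_self _) hδ.le) h1

theorem abs_sSup_image_sub_le {α : Type*} {S : Set α} (hS : S.Nonempty) {f g : α → ℝ}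
    (hf : BddAbove (f '' S)) (hg : BddAbove (g '' S)) {B : ℝ} (h : ∀ a ∈ S, |f a - g a| ≤ B) :
    |sSup (f '' S) - sSup (g '' S)| ≤ B := by
  rw [abs_sub_le_iff, sub_le_iff_le_add, sub_le_iff_le_add]
  constructor
  · refine csSup_le (hS.image f) ?_
    rintro _ ⟨a, ha, rfl⟩
    linarith [(abs_sub_le_iff.1 (h a ha)).1, le_csSup hg (Set.mem_image_of_mem g ha)]
  · refine csSup_le (hS.image g) ?_
    rintro _ ⟨a, ha, rfl⟩
    linarith [(abs_sub_le_iff.1 (h a ha)).2, le_csSup hf (Set.mem_image_of_mem f ha)]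

/-- Near a given point the slopes vary by an amount bounded independently of `v`, so their supremum
is continuous. Joint continuity in position and velocity is what makes the speeds integrable. -/
theorem continuousOn_slopeSup {n : ℕ} {Ω : Set (Hyp n)} (hopen : IsOpen Ω) :
    ContinuousOn (fun p : Lorentz n × Lorentz n => slopeSup Ω p.1 p.2)
      (coneOver Ω ×ˢ Set.univ) := by
  rcases (unitNormals Ω).eq_empty_or_nonempty with hN | hN
  · simp only [slopeSup, hN, Set.image_empty]
    exact continuousOn_const
  rintro ⟨x, ξ⟩ ⟨hx, -⟩
  obtain ⟨δ, hδ, hball, h⟩ := exists_abs_lor_mul_le hopen hx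
  refine ContinuousAt.continuousWithinAt ?_
  have hB : Filter.Tendsto (fun p : Lorentz n × Lorentz n =>
      ‖p.2 - ξ‖ / δ + ‖ξ‖ / δ * (‖p.1 - x‖ / δ)) (nhds (x, ξ)) (nhds 0) := by
    have : Continuous (fun p : Lorentz n × Lorentz n =>
      ‖p.2 - ξ‖ / δ + ‖ξ‖ / δ * (‖p.1 - x‖ / δ)) := by fun_prop
    convert this.tendsto (x, ξ) using 2
    simp
  refine tendsto_iff_dist_tendsto_zero.2
    (squeeze_zero' (Filter.Eventually.of_forall fun _ => dist_nonneg) ?_ hB)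
  have hev : ∀ᶠ p : Lorentz n × Lorentz n in nhds (x, ξ), p.1 ∈ Metric.ball x δ :=
    continuous_fst.continuousAt.eventually (Metric.ball_mem_nhds x hδ)
  filter_upwards [hev] with p hp
  rw [Real.dist_eq]
  refine abs_sSup_image_sub_le hN (bddAbove_slope hopen (hball hp) _)
    (bddAbove_slope hopen hx _) fun v hv => ?_
  have hx0 := neg_pos.2 (lor_neg_of_mem_coneOver hx hv)
  have hp0 := neg_pos.2 (lor_neg_of_mem_coneOver (hball hp) hv)
  have hbound : ∀ y ∈ Metric.ball x δ, ∀ ζ : Lorentz n, |lor ζ v / -lor y v| ≤ ‖ζ‖ / δ := by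
    intro y hy ζ
    have hy0 := neg_pos.2 (lor_neg_of_mem_coneOver (hball hy) hv)
    rw [abs_div, abs_of_pos hy0, div_le_div_iff₀ hy0 hδ]
    exact h y hy v hv ζ
  have hself := Metric.mem_ball_self (x := x) hδ
  have key : slope p.1 p.2 v - slope x ξ v =
      lor (p.2 - ξ) v / -lor p.1 v + lor ξ v / -lor x v * (lor (p.1 - x) v / -lor p.1 v) := by
    have h1 : lor p.1 v ≠ 0 := by linarith
    have h2 : lor x v ≠ 0 := by linarith
    simp only [slope, lor_sub_left, lor_comm v]
    field_simp
    ring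
  rw [key]
  refine (abs_add_le _ _).trans (add_le_add (hbound _ hp _) ?_)
  rw [abs_mul]
  exact mul_le_mul (hbound _ hself _) (hbound _ hp _) (abs_nonneg _) (by positivity)

/-- Otherwise the interval `[0, t]` would be split between the preimages of `Ω` and of its exterior,
contradicting connectedness. -/
theorem exists_geo_mem_frontier {n : ℕ} {Ω : Set (Hyp n)} (hopen : IsOpen Ω) {x : Hyp n}
    (hxΩ : x ∈ Ω) {u : Lorentz n} (hx : lor x.1 u = 0) (hu : lor u u = 1)
    (h : ¬ ray x u ⊆ Ω) : ∃ D, 0 < D ∧ geo x u hx hu D ∈ frontier Ω := by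
  obtain ⟨z, hz, hzΩ⟩ := Set.not_subset.1 h
  obtain ⟨t, ht, rfl⟩ := (mem_ray_unit x u hx hu z).1 hz
  have hc := continuous_geo x u hx hu
  by_contra hno
  push Not at hno
  have hcover : Set.Icc 0 t ⊆ geo x u hx hu ⁻¹' Ω ∪ geo x u hx hu ⁻¹' (closure Ω)ᶜ := by
    intro s hs
    by_cases hsΩ : geo x u hx hu s ∈ Ω
    · exact Or.inl hsΩ
    · refine Or.inr fun hcl => ?_
      have hs0 : 0 < s := by
        rcases hs.1.eq_or_lt with rfl | h
        · exact absurd (by rwa [geo_zero]) hsΩ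
        · exact h
      exact hno s hs0 (by rw [hopen.frontier_eq]; exact ⟨hcl, hsΩ⟩)
  rcases (isPreconnected_Icc (a := (0 : ℝ)) (b := t)).subset_or_subset (hopen.preimage hc)
    (isClosed_closure.isOpen_compl.preimage hc)
    ((Set.disjoint_compl_right_iff_subset.2 subset_closure).preimage _) hcover with h1 | h1
  · exact hzΩ (h1 ⟨ht.le, le_rfl⟩)
  · have := h1 ⟨le_rfl, ht.le⟩
    rw [Set.mem_preimage, geo_zero] at this
    exact this (subset_closure hxΩ)

/-! ### Weak norms -/

theorem minkowski_eq {n : ℕ} {Ω : Set (Hyp n)} {x : Hyp n} (hx : x ∈ Ω) {ξ : Lorentz n}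
    (hξ : lor x.1 ξ = 0) : minkowski Ω x ξ = slopeSup Ω x.1 ξ := by
  rw [minkowski, minkowskiSet_eq hx hξ, slopeSup]

/-- Taking the maximum with a constant commutes with a nonempty supremum. Without normals the left
side is `0` by convention, while `hnorm ξ` would survive on the right. -/
theorem rayMinkowski_eq {n : ℕ} {Ω : Set (Hyp n)} (hopen : IsOpen Ω)
    (hN : (unitNormals Ω).Nonempty) {x : Hyp n} (hx : x ∈ Ω) {ξ : Lorentz n}
    (hξ : lor x.1 ξ = 0) : rayMinkowski Ω x ξ = max (hnorm ξ) (slopeSup Ω x.1 ξ) := by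
  have hb := bddAbove_slope hopen (mem_coneOver hx) ξ
  rw [rayMinkowski, rayMinkowskiSet_eq hx hξ]
  refine IsLUB.csSup_eq ⟨?_, fun c hc => ?_⟩ (hN.image _)
  · rintro _ ⟨v, hv, rfl⟩
    exact max_le_max le_rfl (le_csSup hb ⟨v, hv, rfl⟩)
  · have h : ∀ v ∈ unitNormals Ω, max (hnorm ξ) (slope x.1 ξ v) ≤ c := fun v hv => hc ⟨v, hv, rfl⟩
    refine max_le ((le_max_left _ _).trans (h _ hN.some_mem)) (csSup_le (hN.image _) ?_)
    rintro _ ⟨v, hv, rfl⟩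
    exact (le_max_right _ _).trans (h v hv)

theorem not_isSupporting {n : ℕ} {Ω : Set (Hyp n)} (hN : unitNormals Ω = ∅) (π : Set (Hyp n)) :
    ¬ IsSupporting Ω π := by
  rw [isSupporting_iff, hN]
  rintro ⟨v, hv, -⟩
  exact hv

theorem minkowski_eq_zero {n : ℕ} {Ω : Set (Hyp n)} (hN : unitNormals Ω = ∅) (x : Hyp n)
    (ξ : Lorentz n) : minkowski Ω x ξ = 0 := by
  have : minkowskiSet Ω x ξ = ∅ :=
    Set.eq_empty_of_forall_notMem fun r ⟨π, _, h, _⟩ => not_isSupporting hN π h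
  rw [minkowski, this, Real.sSup_empty]

theorem rayMinkowski_eq_zero {n : ℕ} {Ω : Set (Hyp n)} (hN : unitNormals Ω = ∅) (x : Hyp n)
    (ξ : Lorentz n) : rayMinkowski Ω x ξ = 0 := by
  have : rayMinkowskiSet Ω x ξ = ∅ :=
    Set.eq_empty_of_forall_notMem fun r ⟨π, h, _⟩ => not_isSupporting hN π h
  rw [rayMinkowski, this, Real.sSup_empty]

theorem slope_zero {n : ℕ} (x v : Lorentz n) : slope x 0 v = 0 := by
  rw [slope, lor_zero_right, zero_div]

theorem slopeSup_zero {n : ℕ} (Ω : Set (Hyp n)) (x : Lorentz n) : slopeSup Ω x 0 = 0 := by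
  rcases (unitNormals Ω).eq_empty_or_nonempty with hN | hN
  · rw [slopeSup, hN, Set.image_empty, Real.sSup_empty]
  · have : slope x 0 = fun _ : Lorentz n => 0 := funext (slope_zero x)
    rw [slopeSup, this, hN.image_const, csSup_singleton]

/-- A pointwise supremum of functions linear in the tangent vector. -/
theorem convexOn_slopeSup {n : ℕ} {Ω : Set (Hyp n)} (hopen : IsOpen Ω)
    (hN : (unitNormals Ω).Nonempty) {x : Hyp n} (hx : x ∈ Ω) :
    ConvexOn ℝ (tangent x : Set (Lorentz n)) (slopeSup Ω x.1) := by
  refine ⟨(tangent x).convex, fun a _ b _ s t hs ht _ => csSup_le (hN.image _) ?_⟩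
  rintro _ ⟨v, hv, rfl⟩
  have h : ∀ ζ, slope x.1 ζ v ≤ slopeSup Ω x.1 ζ := fun ζ =>
    le_csSup (bddAbove_slope hopen (mem_coneOver hx) ζ) ⟨v, hv, rfl⟩
  have h1 : slope x.1 (s • a + t • b) v = s • slope x.1 a v + t • slope x.1 b v := by
    simp only [slope, lor_add_right, lor_smul_right, smul_eq_mul]
    ring
  rw [h1]
  exact add_le_add (mul_le_mul_of_nonneg_left (h a) hs) (mul_le_mul_of_nonneg_left (h b) ht)

theorem isWeakNormOn_minkowski {n : ℕ} {Ω : Set (Hyp n)} (hopen : IsOpen Ω) :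
    IsWeakNormOn Ω (minkowski Ω) := by
  intro x hx
  refine ⟨by rw [minkowski_eq hx (lor_zero_right _), slopeSup_zero], ?_⟩
  rcases (unitNormals Ω).eq_empty_or_nonempty with hN | hN
  · rw [funext (minkowski_eq_zero hN x)]
    exact convexOn_const 0 (tangent x).convex
  · exact (convexOn_slopeSup hopen hN hx).congr fun ξ hξ => (minkowski_eq hx hξ).symm

theorem isWeakNormOn_rayMinkowski {n : ℕ} {Ω : Set (Hyp n)} (hopen : IsOpen Ω) :
    IsWeakNormOn Ω (rayMinkowski Ω) := by
  intro x hx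
  rcases (unitNormals Ω).eq_empty_or_nonempty with hN | hN
  · rw [funext (rayMinkowski_eq_zero hN x)]
    exact ⟨rfl, convexOn_const 0 (tangent x).convex⟩
  · refine ⟨?_, ((convexOn_hnorm x).sup (convexOn_slopeSup hopen hN hx)).congr fun ξ hξ =>
      (rayMinkowski_eq hopen hN hx hξ).symm⟩
    rw [rayMinkowski_eq hopen hN hx (lor_zero_right _), slopeSup_zero, hnorm_zero, max_self]

/-! ### Lower bound for the length of a curve -/

/-- What the Finsler distance uses of the two Minkowski functionals. -/
structure IsSlopeBound {n : ℕ} (Ω : Set (Hyp n)) (q : Hyp n → Lorentz n → ℝ) : Prop where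
  exists_continuousOn : ∃ Q : Lorentz n × Lorentz n → ℝ,
    ContinuousOn Q (coneOver Ω ×ˢ Set.univ) ∧ ∀ z ∈ Ω, ∀ ξ, lor z.1 ξ = 0 → q z ξ = Q (z.1, ξ)
  slope_le : ∀ z ∈ Ω, ∀ ξ, lor z.1 ξ = 0 → ∀ v ∈ unitNormals Ω, slope z.1 ξ v ≤ q z ξ
  map_zero : ∀ z ∈ Ω, q z 0 = 0
  -- The condition on `hnorm ξ` selects the vectors where the maximum in the ray form is the slope
  -- supremum.
  eq_slopeSup : (unitNormals Ω).Nonempty → ∀ z ∈ Ω, ∀ ξ, lor z.1 ξ = 0 →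
    hnorm ξ ≤ slopeSup Ω z.1 ξ → q z ξ = slopeSup Ω z.1 ξ
  eq_zero : unitNormals Ω = ∅ → ∀ z ξ, q z ξ = 0

theorem isSlopeBound_minkowski {n : ℕ} {Ω : Set (Hyp n)} (hopen : IsOpen Ω) :
    IsSlopeBound Ω (minkowski Ω) where
  exists_continuousOn := ⟨_, continuousOn_slopeSup hopen, fun _ hz _ hξ => minkowski_eq hz hξ⟩
  slope_le z hz ξ hξ v hv := by
    rw [minkowski_eq hz hξ]
    exact le_csSup (bddAbove_slope hopen (mem_coneOver hz) ξ) ⟨v, hv, rfl⟩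
  map_zero z hz := (isWeakNormOn_minkowski hopen z hz).1
  eq_slopeSup _ _ hz _ hξ _ := minkowski_eq hz hξ
  eq_zero := minkowski_eq_zero

theorem isSlopeBound_rayMinkowski {n : ℕ} {Ω : Set (Hyp n)} (hopen : IsOpen Ω) :
    IsSlopeBound Ω (rayMinkowski Ω) where
  exists_continuousOn := by
    rcases (unitNormals Ω).eq_empty_or_nonempty with hN | hN
    · exact ⟨fun _ => 0, continuousOn_const, fun z _ ξ _ => rayMinkowski_eq_zero hN z ξ⟩
    · refine ⟨fun p => max (hnorm p.2) (slopeSup Ω p.1 p.2),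
        ContinuousOn.sup ?_ (continuousOn_slopeSup hopen),
        fun z hz ξ hξ => rayMinkowski_eq hopen hN hz hξ⟩
      exact ((continuous_lor_self.comp continuous_snd).sqrt).continuousOn
  slope_le z hz ξ hξ v hv := by
    rw [rayMinkowski_eq hopen ⟨v, hv⟩ hz hξ]
    exact (le_csSup (bddAbove_slope hopen (mem_coneOver hz) ξ) ⟨v, hv, rfl⟩).trans
      (le_max_right _ _)
  map_zero z hz := (isWeakNormOn_rayMinkowski hopen z hz).1
  eq_slopeSup hN _ hz _ hξ h := by rw [rayMinkowski_eq hopen hN hz hξ, max_eq_right h]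
  eq_zero := rayMinkowski_eq_zero

/-- Integrability and the lower bound for the length, on one `C¹` piece. -/
theorem IsSlopeBound.integral_piece {n : ℕ} {Ω : Set (Hyp n)} {q : Hyp n → Lorentz n → ℝ}
    (hq : IsSlopeBound Ω q) {γ : ℝ → Hyp n} {s t : ℝ} (hst : s < t)
    (hγ : ContDiffOn ℝ 1 (fun τ => (γ τ).1) (Set.Icc s t)) (hmem : ∀ τ ∈ Set.Icc s t, γ τ ∈ Ω) :
    IntervalIntegrable (speed q γ) MeasureTheory.volume s t ∧ ∀ v ∈ unitNormals Ω,
      Real.log (-lor (γ s).1 v) - Real.log (-lor (γ t).1 v) ≤ ∫ τ in s..t, speed q γ τ := by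
  obtain ⟨Q, hQc, hQ⟩ := hq.exists_continuousOn
  have hD := hγ.continuousOn_derivWithin (uniqueDiffOn_Icc hst) le_rfl
  -- The one-sided derivative is continuous up to the endpoints and agrees with `deriv` inside,
  -- which suffices for integrals.
  set D := derivWithin (fun τ => (γ τ).1) (Set.Icc s t) with hDdef
  have hder : ∀ τ ∈ Set.Ioo s t, HasDerivAt (fun τ => (γ τ).1) (D τ) τ := by
    intro τ hτ
    exact ((hγ.differentiableOn one_ne_zero τ
      (Set.Ioo_subset_Icc_self hτ)).hasDerivWithinAt).hasDerivAt (Icc_mem_nhds hτ.1 hτ.2)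
  have hQcont : ContinuousOn (fun τ => Q ((γ τ).1, D τ)) (Set.Icc s t) :=
    hQc.comp (hγ.continuousOn.prodMk hD) fun τ hτ => ⟨mem_coneOver (hmem τ hτ), trivial⟩
  have htan : ∀ τ ∈ Set.Ioo s t, lor (γ τ).1 (D τ) = 0 := fun τ hτ =>
    lor_eq_zero_of_hasDerivAt (hder τ hτ)
  have hspeed : ∀ τ ∈ Set.Ioo s t, speed q γ τ = q (γ τ) (D τ) := fun τ hτ => by
    rw [speed, (hder τ hτ).deriv]
  have hint : IntervalIntegrable (speed q γ) MeasureTheory.volume s t := by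
    refine (hQcont.intervalIntegrable_of_Icc hst.le).congr_uIoo fun τ hτ => ?_
    rw [Set.uIoo_of_le hst.le] at hτ
    rw [hspeed τ hτ]
    exact (hQ _ (hmem τ (Set.Ioo_subset_Icc_self hτ)) _ (htan τ hτ)).symm
  refine ⟨hint, fun v hv => ?_⟩
  have hpos : ∀ τ ∈ Set.Icc s t, 0 < -lor (γ τ).1 v := fun τ hτ =>
    neg_pos.2 (hv.2.1 _ (hmem τ hτ))
  have hcl : ContinuousOn (fun τ => -lor (γ τ).1 v) (Set.Icc s t) := by
    simp only [← lorL_apply]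
    exact ((lorL v).continuous.comp_continuousOn hγ.continuousOn).neg
  have hslc : ContinuousOn (fun τ => slope (γ τ).1 (D τ) v) (Set.Icc s t) := by
    refine ContinuousOn.div ?_ hcl fun τ hτ => (hpos τ hτ).ne'
    simp only [lor_comm v, ← lorL_apply]
    exact (lorL v).continuous.comp_continuousOn hD
  have hsli := hslc.intervalIntegrable_of_Icc (μ := MeasureTheory.volume) hst.le
  -- The potential `-log (-lor γ v)` has derivative the slope of `v` along `γ`, which the speed
  -- dominates.
  have hftc := intervalIntegral.integral_eq_sub_of_hasDerivAt_of_le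
    (f := fun τ => -Real.log (-lor (γ τ).1 v)) hst.le
    (hcl.log fun τ hτ => (hpos τ hτ).ne').neg (fun τ hτ => by
      have h1 : HasDerivAt (fun τ => -lor (γ τ).1 v) (-lor (D τ) v) τ := by
        have := (lorL v).hasFDerivAt.comp_hasDerivAt τ (hder τ hτ)
        simp only [Function.comp_def, lorL_apply] at this
        exact this.neg
      refine (h1.log (hpos τ (Set.Ioo_subset_Icc_self hτ)).ne').neg.congr_deriv
        (g' := slope (γ τ).1 (D τ) v) ?_
      rw [slope, lor_comm v, neg_div, neg_neg]) hsli
  rw [neg_sub_neg] at hftc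
  rw [← hftc]
  refine intervalIntegral.integral_mono_on_of_le_Ioo hst.le hsli hint fun τ hτ => ?_
  rw [hspeed τ hτ]
  exact hq.slope_le _ (hmem τ (Set.Ioo_subset_Icc_self hτ)) _ (htan τ hτ) v hv

theorem IsSlopeBound.integral_path {n : ℕ} {Ω : Set (Hyp n)} {q : Hyp n → Lorentz n → ℝ}
    (hq : IsSlopeBound Ω q) {x y : Hyp n} {γ : ℝ → Hyp n} {a b : ℝ}
    (hγ : IsPiecewiseC1Path Ω x y a b γ) :
    IntervalIntegrable (speed q γ) MeasureTheory.volume a b ∧ ∀ v ∈ unitNormals Ω,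
      Real.log (-lor x.1 v) - Real.log (-lor y.1 v) ≤ ∫ τ in a..b, speed q γ τ := by
  obtain ⟨-, rfl, rfl, hmem, m, s, rfl, rfl, hs⟩ := hγ
  have hmono : ∀ i j, i ≤ j → j ≤ m → s i ≤ s j := by
    intro i j hij
    induction j, hij using Nat.le_induction with
    | base => exact fun _ => le_rfl
    | succ j _ ih => exact fun hj => (ih (by omega)).trans (hs j hj).1.le
  have key : ∀ k ≤ m, IntervalIntegrable (speed q γ) MeasureTheory.volume (s 0) (s k) ∧
      ∀ v ∈ unitNormals Ω, Real.log (-lor (γ (s 0)).1 v) - Real.log (-lor (γ (s k)).1 v) ≤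
        ∫ τ in s 0..s k, speed q γ τ := by
    intro k
    induction k with
    | zero => simp
    | succ k ih =>
      intro hk
      obtain ⟨h1, h2⟩ := ih (by omega)
      obtain ⟨h3, h4⟩ := hq.integral_piece (hs k hk).1 (hs k hk).2 fun τ hτ =>
        hmem τ ⟨(hmono 0 k (Nat.zero_le _) (by omega)).trans hτ.1, hτ.2.trans (hmono _ m hk le_rfl)⟩
      refine ⟨h1.trans h3, fun v hv => ?_⟩
      rw [← intervalIntegral.integral_add_adjacent_intervals h1 h3]
      linarith [h2 v hv, h4 v hv]
  exact key m le_rfl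

/-! ### The Funk metric as a maximum of potential differences -/

theorem exists_funk_eq {n : ℕ} {Ω : Set (Hyp n)} (hopen : IsOpen Ω) (hconv : HConvex Ω)
    {x y : Hyp n} (hxΩ : x ∈ Ω) (hyΩ : y ∈ Ω) (hne : x ≠ y) (h : ¬ ray x (unitDir x y) ⊆ Ω) :
    ∃ D, hdist x y < D ∧
      geo x (unitDir x y) (lor_unitDir x y) (lor_unitDir_self hne) D ∈ frontier Ω ∧
      funk Ω x y = Real.log (Real.sinh D) - Real.log (Real.sinh (D - hdist x y)) := by
  have hx := lor_unitDir x y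
  have hu := lor_unitDir_self hne
  have hdisj : ∀ z ∈ frontier Ω, z ∉ Ω := fun z hz hzΩ => (hopen.frontier_eq ▸ hz).2 hzΩ
  obtain ⟨D₀, hD₀, hD₀f⟩ := exists_geo_mem_frontier hopen hxΩ hx hu h
  have hex : x ≠ y ∧ (ray x (unitDir x y) ∩ frontier Ω).Nonempty :=
    ⟨hne, _, (mem_ray_unit x _ hx hu _).2 ⟨D₀, hD₀, rfl⟩, hD₀f⟩
  obtain ⟨hb1, hb2⟩ := hex.2.some_mem
  obtain ⟨D, hD, hbD⟩ := (mem_ray_unit x _ hx hu _).1 hb1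
  rw [hbD] at hb2
  -- The segment from `x` to `y` lies in the open set `Ω`, so whichever frontier point was chosen
  -- lies beyond `y`; uniqueness is not needed.
  have hlt : hdist x y < D := by
    by_contra hc
    push Not at hc
    exact hdisj _ hb2 (hconv x hxΩ y hyΩ ⟨D, hD.le, hc, (hexp_smul_unit x _ hx hu D).symm⟩)
  refine ⟨D, hlt, hb2, ?_⟩
  have h1 : hdist x (geo x _ hx hu D) = D := by
    have := hdist_geo x _ hx hu 0 D
    rwa [geo_zero, sub_zero, abs_of_pos hD] at this
  have h2 : hdist y (geo x _ hx hu D) = D - hdist x y := by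
    have := hdist_geo x _ hx hu (hdist x y) D
    rwa [geo_unitDir hne, abs_of_pos (sub_pos.2 hlt)] at this
  rw [funk, dif_pos hex, hbD, h1, h2, Real.log_div (Real.sinh_pos_iff.2 hD).ne'
    (Real.sinh_pos_iff.2 (sub_pos.2 hlt)).ne']

theorem sinh_mul_lor {n : ℕ} {x y : Hyp n} (hne : x ≠ y) (D : ℝ) (v : Lorentz n) :
    Real.sinh D * -lor y.1 v = Real.sinh (D - hdist x y) * -lor x.1 v - Real.sinh (hdist x y) *
      lor (geo x (unitDir x y) (lor_unitDir x y) (lor_unitDir_self hne) D).1 v := by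
  have h := congrArg (fun u => lor u v)
    (geo_combination x _ (lor_unitDir x y) (lor_unitDir_self hne) D (hdist x y))
  simp only [geo_unitDir hne, lor_add_left, lor_smul_left] at h
  linarith

theorem funk_self {n : ℕ} (Ω : Set (Hyp n)) (x : Hyp n) : funk Ω x x = 0 :=
  dif_neg fun h => h.1 rfl

/-- Expressing `y` through `x` and `b` as in `sinh_mul_lor`, the term with `lor b v ≤ 0` has a
favourable sign. -/
theorem log_sub_log_le_funk {n : ℕ} {Ω : Set (Hyp n)} (hopen : IsOpen Ω) (hconv : HConvex Ω)
    {x y : Hyp n} (hxΩ : x ∈ Ω) (hyΩ : y ∈ Ω) (h : x ≠ y → ¬ ray x (unitDir x y) ⊆ Ω)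
    {v : Lorentz n} (hv : v ∈ unitNormals Ω) :
    Real.log (-lor x.1 v) - Real.log (-lor y.1 v) ≤ funk Ω x y := by
  rcases eq_or_ne x y with rfl | hne
  · rw [funk_self, sub_self]
  obtain ⟨D, hD, hb, hF⟩ := exists_funk_eq hopen hconv hxΩ hyΩ hne (h hne)
  have hd := hdist_pos hne
  have hA : 0 < -lor x.1 v := neg_pos.2 (hv.2.1 x hxΩ)
  have hB : 0 < -lor y.1 v := neg_pos.2 (hv.2.1 y hyΩ)
  have hs1 := Real.sinh_pos_iff.2 (hd.trans hD)
  have hs2 := Real.sinh_pos_iff.2 (sub_pos.2 hD)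
  have hbv := lor_nonpos_of_mem_closure hb.1 fun z hz => (hv.2.1 z hz).le
  have hle : Real.sinh (D - hdist x y) * -lor x.1 v ≤ Real.sinh D * -lor y.1 v := by
    rw [sinh_mul_lor hne D v]
    nlinarith [Real.sinh_pos_iff.2 hd]
  have := Real.log_le_log (mul_pos hs2 hA) hle
  rw [Real.log_mul hs2.ne' hA.ne', Real.log_mul hs1.ne' hB.ne'] at this
  linarith

/-- For a hyperplane through `b` the term with `lor b v` vanishes, so the bound of
`log_sub_log_le_funk` is attained. -/
theorem exists_funk_eq_log_sub_log {n : ℕ} {Ω : Set (Hyp n)} (hopen : IsOpen Ω)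
    (hconv : HConvex Ω) {x y : Hyp n} (hxΩ : x ∈ Ω) (hyΩ : y ∈ Ω) (hne : x ≠ y)
    (h : ¬ ray x (unitDir x y) ⊆ Ω) : ∃ v ∈ unitNormals Ω,
      funk Ω x y = Real.log (-lor x.1 v) - Real.log (-lor y.1 v) := by
  obtain ⟨D, hD, hb, hF⟩ := exists_funk_eq hopen hconv hxΩ hyΩ hne h
  obtain ⟨v, hv, hbv⟩ := exists_unitNormal hopen hconv hb
  have hd := hdist_pos hne
  have hA : 0 < -lor x.1 v := neg_pos.2 (hv.2.1 x hxΩ)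
  have hB : 0 < -lor y.1 v := neg_pos.2 (hv.2.1 y hyΩ)
  have hs1 := Real.sinh_pos_iff.2 (hd.trans hD)
  have hs2 := Real.sinh_pos_iff.2 (sub_pos.2 hD)
  have heq := sinh_mul_lor hne D v
  rw [hbv, mul_zero, sub_zero] at heq
  have := congrArg Real.log heq
  rw [Real.log_mul hs2.ne' hA.ne', Real.log_mul hs1.ne' hB.ne'] at this
  exact ⟨v, hv, by linarith⟩

/-! ### The geodesic segment realizes the Funk metric -/

/-- The maximal slope along a geodesic that reaches the frontier at time `D`. -/
theorem slopeSup_geo {n : ℕ} {Ω : Set (Hyp n)} (hopen : IsOpen Ω) (hconv : HConvex Ω)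
    {x : Hyp n} {u : Lorentz n} (hx : lor x.1 u = 0) (hu : lor u u = 1) {D t : ℝ}
    (hb : geo x u hx hu D ∈ frontier Ω) (htD : t < D) (ht : geo x u hx hu t ∈ Ω) :
    slopeSup Ω (geo x u hx hu t).1 (Real.sinh t • x.1 + Real.cosh t • u) =
      Real.cosh (D - t) / Real.sinh (D - t) := by
  have hs := Real.sinh_pos_iff.2 (sub_pos.2 htD)
  -- The frontier point is reached from time `t` after a further time `D - t`. Pairing with `v` and
  -- using `lor b v ≤ 0` gives slope at most `coth (D - t)`, with equality for a hyperplane through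
  -- the frontier point.
  have hcomb : (geo x u hx hu D).1 = Real.cosh (D - t) • (geo x u hx hu t).1 +
      Real.sinh (D - t) • (Real.sinh t • x.1 + Real.cosh t • u) := by
    have h1 := Real.cosh_add (D - t) t
    have h2 := Real.sinh_add (D - t) t
    rw [sub_add_cancel] at h1 h2
    rw [geo_coe, geo_coe, h1, h2]
    module
  have hlor : ∀ v, lor (geo x u hx hu D).1 v = Real.cosh (D - t) * lor (geo x u hx hu t).1 v +
      Real.sinh (D - t) * lor v (Real.sinh t • x.1 + Real.cosh t • u) := by
    intro v
    rw [hcomb, lor_add_left, lor_smul_left, lor_smul_left (Real.sinh (D - t)), lor_comm v]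
  refine IsGreatest.csSup_eq ⟨?_, ?_⟩
  · obtain ⟨v, hv, hbv⟩ := exists_unitNormal hopen hconv hb
    have hneg := hv.2.1 _ ht
    refine ⟨v, hv, ?_⟩
    have := hlor v
    rw [hbv] at this
    rw [slope, div_eq_div_iff (by linarith) hs.ne']
    linarith
  · rintro _ ⟨v, hv, rfl⟩
    have hneg := hv.2.1 _ ht
    have := hlor v
    have hbv := lor_nonpos_of_mem_closure hb.1 fun z hz => (hv.2.1 z hz).le
    rw [slope, div_le_div_iff₀ (by linarith) hs]
    linarith

theorem integral_coth_sub {d D : ℝ} (hd : 0 ≤ d) (hD : d < D) :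
    ∫ t in (0 : ℝ)..d, Real.cosh (D - t) / Real.sinh (D - t) =
      Real.log (Real.sinh D) - Real.log (Real.sinh (D - d)) := by
  have hpos : ∀ t ∈ Set.uIcc 0 d, 0 < Real.sinh (D - t) := by
    intro t ht
    rw [Set.uIcc_of_le hd] at ht
    exact Real.sinh_pos_iff.2 (by linarith [ht.2])
  have h := intervalIntegral.integral_eq_sub_of_hasDerivAt
    (f := fun t => -Real.log (Real.sinh (D - t)))
    (f' := fun t => Real.cosh (D - t) / Real.sinh (D - t)) (a := 0) (b := d) (fun t ht => by
      have h1 : HasDerivAt (fun t => D - t) (-1) t := by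
        simpa using (hasDerivAt_id t).const_sub D
      refine ((h1.sinh).log (hpos t ht).ne').neg.congr_deriv ?_
      ring) (ContinuousOn.intervalIntegrable (ContinuousOn.div (by fun_prop) (by fun_prop)
        fun t ht => (hpos t ht).ne'))
  rw [h, sub_zero]
  ring

theorem IsSlopeBound.funk_mem_lengths {n : ℕ} {Ω : Set (Hyp n)} {q : Hyp n → Lorentz n → ℝ}
    (hq : IsSlopeBound Ω q) (hopen : IsOpen Ω) (hconv : HConvex Ω) {x y : Hyp n} (hxΩ : x ∈ Ω)
    (hyΩ : y ∈ Ω) (h : x ≠ y → ¬ ray x (unitDir x y) ⊆ Ω) : funk Ω x y ∈ lengths Ω q x y := by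
  rcases eq_or_ne x y with rfl | hne
  · refine ⟨0, 1, fun _ => x, ⟨one_pos, rfl, rfl, fun _ _ => hxΩ, 1, fun i => i, by simp, by simp,
      fun i _ => ⟨by push_cast; linarith, contDiffOn_const⟩⟩, ?_⟩
    simp [funk_self, speed, hq.map_zero x hxΩ]
  obtain ⟨D, hD, hb, hF⟩ := exists_funk_eq hopen hconv hxΩ hyΩ hne (h hne)
  have hd := hdist_pos hne
  have hx := lor_unitDir x y
  have hu := lor_unitDir_self hne
  set u := unitDir x y
  set d := hdist x y
  have hmem : ∀ t ∈ Set.Icc 0 d, geo x u hx hu t ∈ Ω := fun t ht =>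
    hconv x hxΩ y hyΩ ⟨t, ht.1, ht.2, (hexp_smul_unit x u hx hu t).symm⟩
  refine ⟨0, d, geo x u hx hu, ⟨hd, geo_zero x u hx hu, geo_unitDir hne, hmem, 1,
    fun i => i * d, by simp, by simp, fun i _ => ⟨by push_cast; linarith,
      (contDiff_geo x u hx hu).contDiffOn⟩⟩, ?_⟩
  rw [hF, ← integral_coth_sub hd.le hD]
  refine intervalIntegral.integral_congr fun t ht => ?_
  rw [Set.uIcc_of_le hd.le] at ht
  have hder := hasDerivAt_geo x u hx hu t
  have htan := lor_eq_zero_of_hasDerivAt hder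
  have hs := slopeSup_geo hopen hconv hx hu hb (ht.2.trans_lt hD) (hmem t ht)
  obtain ⟨v, hv, -⟩ := exists_unitNormal hopen hconv hb
  simp only [speed, hder.deriv]
  rw [hq.eq_slopeSup ⟨v, hv⟩ _ (hmem t ht) _ htan, hs]
  -- The velocity is a unit vector, so the hypothesis of `eq_slopeSup` reads `1 ≤ coth (D - t)`.
  have h1 : lor (Real.sinh t • x.1 + Real.cosh t • u) (Real.sinh t • x.1 + Real.cosh t • u) = 1 := by
    simp only [lor_add_right, lor_smul_right, lor_add_left, lor_smul_left, x.2.1, hx, hu,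
      lor_comm u x.1]
    linarith [Real.cosh_sq t]
  rw [hs, hnorm, h1, Real.sqrt_one,
    one_le_div (Real.sinh_pos_iff.2 (sub_pos.2 (ht.2.trans_lt hD)))]
  exact (Real.sinh_lt_cosh _).le

/-! ### Finsler distance, weak metric and equality of the two forms -/

theorem IsSlopeBound.finslerDistEq {n : ℕ} {Ω : Set (Hyp n)} {q : Hyp n → Lorentz n → ℝ}
    (hq : IsSlopeBound Ω q) (hopen : IsOpen Ω) (hconv : HConvex Ω) {x y : Hyp n} (hxΩ : x ∈ Ω)
    (hyΩ : y ∈ Ω) (h : x ≠ y → ¬ ray x (unitDir x y) ⊆ Ω) :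
    FinslerDistEq Ω q x y (funk Ω x y) := by
  refine ⟨fun a b γ hγ => (hq.integral_path hγ).1,
    IsLeast.isGLB ⟨hq.funk_mem_lengths hopen hconv hxΩ hyΩ h, ?_⟩⟩
  rintro _ ⟨a, b, γ, hγ, rfl⟩
  rcases eq_or_ne x y with rfl | hne
  · rw [funk_self]
    -- For a closed curve the potential difference is `0` for any normal; with no normals the
    -- integrand vanishes.
    rcases (unitNormals Ω).eq_empty_or_nonempty with hN | ⟨v, hv⟩
    · simp [speed, hq.eq_zero hN]
    · simpa using (hq.integral_path hγ).2 v hv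
  · obtain ⟨v, hv, hF⟩ := exists_funk_eq_log_sub_log hopen hconv hxΩ hyΩ hne (h hne)
    rw [hF]
    exact (hq.integral_path hγ).2 v hv

/-- For the triangle inequality, the potential attaining `F(x, z)` telescopes through `y`, and each
of its two differences is bounded by the corresponding value of `F`. -/
theorem isWeakMetricOn_funk {n : ℕ} {Ω : Set (Hyp n)} (hopen : IsOpen Ω) (hconv : HConvex Ω)
    (h : ∀ x ∈ Ω, ∀ y ∈ Ω, x ≠ y → ¬ ray x (unitDir x y) ⊆ Ω) :
    IsWeakMetricOn Ω (funk Ω) := by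
  have hnonneg : ∀ x ∈ Ω, ∀ y ∈ Ω, 0 ≤ funk Ω x y := by
    intro x hx y hy
    rcases eq_or_ne x y with rfl | hne
    · rw [funk_self]
    obtain ⟨D, hD, -, hF⟩ := exists_funk_eq hopen hconv hx hy hne (h x hx y hy hne)
    rw [hF, sub_nonneg]
    exact Real.log_le_log (Real.sinh_pos_iff.2 (sub_pos.2 hD))
      (Real.sinh_le_sinh.2 (by linarith [hdist_pos hne]))
  refine ⟨hnonneg, fun x _ => funk_self Ω x, fun x hx y hy z hz => ?_⟩
  rcases eq_or_ne x z with rfl | hne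
  · rw [funk_self]
    exact add_nonneg (hnonneg _ hx _ hy) (hnonneg _ hy _ hz)
  obtain ⟨v, hv, hF⟩ := exists_funk_eq_log_sub_log hopen hconv hx hz hne (h x hx z hz hne)
  linarith [log_sub_log_le_funk hopen hconv hx hy (h x hx y hy) hv,
    log_sub_log_le_funk hopen hconv hy hz (h y hy z hz) hv]

/-- A hyperplane through an exit point at distance `D` has slope `coth D · ‖ξ‖ ≥ ‖ξ‖`, so the
maximum with `‖ξ‖` has no effect. -/
theorem rayMinkowski_eq_minkowski {n : ℕ} {Ω : Set (Hyp n)} (hopen : IsOpen Ω)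
    (hconv : HConvex Ω) {x : Hyp n} (hx : x ∈ Ω) {ξ : Lorentz n} (hξ : lor x.1 ξ = 0)
    (h : ¬ ray x ξ ⊆ Ω) : rayMinkowski Ω x ξ = minkowski Ω x ξ := by
  have hne : ξ ≠ 0 := by
    rintro rfl
    rw [ray_zero, Set.singleton_subset_iff] at h
    exact h hx
  have hr := hnorm_pos x hξ hne
  obtain ⟨u, hxu, hu, hξu⟩ := exists_eq_smul_unit x hξ hne
  have hray : ray x ξ = ray x u := by rw [hξu, ray_smul x u hr]
  obtain ⟨D, hD, hb⟩ := exists_geo_mem_frontier hopen hx hxu hu (hray ▸ h)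
  obtain ⟨v, hv, hbv⟩ := exists_unitNormal hopen hconv hb
  rw [rayMinkowski_eq hopen ⟨v, hv⟩ hx hξ, minkowski_eq hx hξ]
  refine max_eq_right (le_trans ?_ (le_csSup (bddAbove_slope hopen (mem_coneOver hx) ξ)
    ⟨v, hv, rfl⟩))
  have hneg := hv.2.1 x hx
  rw [geo_coe, lor_add_left, lor_smul_left, lor_smul_left, lor_comm u] at hbv
  have hle : -lor x.1 v ≤ lor v u := by
    have h1 := Real.sinh_lt_cosh D
    have h2 := Real.sinh_pos_iff.2 hD
    by_contra hc
    push Not at hc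
    nlinarith
  have : slope x.1 ξ v = hnorm ξ * (lor v u / -lor x.1 v) := by
    conv_lhs => rw [hξu]
    rw [slope, lor_smul_right, mul_div_assoc]
  rw [this]
  exact le_mul_of_one_le_right hr.le ((one_le_div (by linarith)).2 hle)

end HypFunk

theorem mainTheorem2 (n : ℕ) (Ω : Set (HypFunk.Hyp n)) (hopen : IsOpen Ω)
    (hconv : HypFunk.HConvex Ω) :
    -- both suprema are finite and define weak norms on the tangent spaces
    (∀ x ∈ Ω, ∀ ξ ∈ HypFunk.tangent x,
      BddAbove (HypFunk.minkowskiSet Ω x ξ) ∧ BddAbove (HypFunk.rayMinkowskiSet Ω x ξ)) ∧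
    HypFunk.IsWeakNormOn Ω (HypFunk.minkowski Ω) ∧
    HypFunk.IsWeakNormOn Ω (HypFunk.rayMinkowski Ω) ∧
    -- the two forms agree on every direction whose ray leaves `Ω`
    (∀ x ∈ Ω, ∀ ξ ∈ HypFunk.tangent x, ¬ HypFunk.ray x ξ ⊆ Ω →
      HypFunk.rayMinkowski Ω x ξ = HypFunk.minkowski Ω x ξ) ∧
    -- the Finsler distance is the Funk metric
    (∀ x ∈ Ω, ∀ y ∈ Ω, (x ≠ y → ¬ HypFunk.ray x (HypFunk.unitDir x y) ⊆ Ω) →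
      HypFunk.FinslerDistEq Ω (HypFunk.minkowski Ω) x y (HypFunk.funk Ω x y) ∧
      HypFunk.FinslerDistEq Ω (HypFunk.rayMinkowski Ω) x y (HypFunk.funk Ω x y)) ∧
    -- if no ray stays in `Ω`, the Funk metric is a weak metric
    ((∀ x ∈ Ω, ∀ y ∈ Ω, x ≠ y → ¬ HypFunk.ray x (HypFunk.unitDir x y) ⊆ Ω) →
      HypFunk.IsWeakMetricOn Ω (HypFunk.funk Ω)) := by
  refine ⟨fun x hx ξ hξ => ?_, HypFunk.isWeakNormOn_minkowski hopen,
    HypFunk.isWeakNormOn_rayMinkowski hopen,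
    fun x hx ξ hξ h => HypFunk.rayMinkowski_eq_minkowski hopen hconv hx hξ h,
    fun x hx y hy h =>
      ⟨(HypFunk.isSlopeBound_minkowski hopen).finslerDistEq hopen hconv hx hy h,
        (HypFunk.isSlopeBound_rayMinkowski hopen).finslerDistEq hopen hconv hx hy h⟩,
    HypFunk.isWeakMetricOn_funk hopen hconv⟩
  have hb := HypFunk.bddAbove_slope hopen (HypFunk.mem_coneOver hx) ξ
  rw [HypFunk.minkowskiSet_eq hx hξ, HypFunk.rayMinkowskiSet_eq hx hξ]
  refine ⟨hb, ?_⟩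
  obtain ⟨c, hc⟩ := hb
  refine ⟨max (HypFunk.hnorm ξ) c, ?_⟩
  rintro _ ⟨v, hv, rfl⟩
  exact max_le_max le_rfl (hc ⟨v, hv, rfl⟩)
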